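/- Let $\sigma^{(1)}=\begin{pmatrix}0&1\\1&0\end{pmatrix}$, $\sigma^{(2)}=\begin{pmatrix}0&-i\\i&0\end{pmatrix}$, $\sigma^{(3)}=\begin{pmatrix}1&0\\0&-1\end{pmatrix}$ be the Pauli matrices, and for $n\ge 2$, $1\le j\le n$, $1\le a\le 3$ let $\sigma^{(a)}_j=I_2^{\otimes(j-1)}\otimes\sigma^{(a)}\otimes I_2^{\otimes(n-j)}$, with cyclic labelling $\sigma^{(a)}_{n+1}=\sigma^{(a)}_1$. For $x=(x_{a,b,j})\in\mathbb{R}^{9n}$ ($1\le a,b\le 3$, $1\le j\le n$) consider the Hermitian $2^n\times 2^n$ matrix \[H_n=\sum_{j=1}^n\sum_{a,b=1}^3 x_{a,b,j}\,\sigma^{(a)}_j\sigma^{(b)}_{j+1}\] with eigenvalues $\lambda_1\le\dots\le\lambda_{2^n}$ (counted with multiplicity), and its spectral measure $\mu_n=2^{-n}\sum_{k=1}^{2^n}\delta_{\lambda_k}$. Let the coefficient vector $x$ be random, uniformly distributed on the unit sphere $S^{9n-1}\subset\mathbb{R}^{9n}$, and let $\mu_n^{DOS}=\mathbb{E}\mu_n$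 be the density of states measure, i.e. $\mu_n^{DOS}(A)=\mathbb{E}[\mu_n(A)]$ for Borel sets $A\subseteq\mathbb{R}$. For probability measures $\mu,\nu$ on $\mathbb{R}$ let \[d_{BL}(\mu,\nu)=\sup\left\{\left|\int f\,d\mu-\int f\,d\nu\right| : \|f\|_\infty+|f|_L\le 1\right\},\] where $|f|_L$ is the Lipschitz constant of $f:\mathbb{R}\to\mathbb{R}$. Then there are universal constants $C,C',c>0$ such that \begin{enumerate} \item[(a)] for all $n\ge 2$, $\displaystyle\mathbb{E}\,d_{BL}(\mu_n,\mu_n^{DOS})\le \frac{C}{n^{1/6}}$; \item[(b)] for all $n\ge 2$ and all $t\ge 0$, $\displaystyle\mathbb{P}\left[d_{BL}(\mu_n,\mu_n^{DOS})\ge\frac{C}{n^{1/6}}+t\right]\le Ce^{-cnt^2}$; \item[(c)] whatever the joint distribution of the coefficient vectors for different $n$, with probability $1$, $\displaystyle d_{BL}(\mu_n,\mu_n^{DOS})\le\frac{C'}{n^{1/6}}$ for all sufficiently large $n$. \end{enumerate} -/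

import Mathlib

open MeasureTheory ProbabilityTheory Filter
open scoped ENNReal NNReal Topology

namespace SpinChain

noncomputable section

/-! ### The Hamiltonian -/

/-- The three non-trivial Pauli matrices. -/
def pauli : Fin 3 → Matrix (Fin 2) (Fin 2) ℂ :=
  ![!![0, 1; 1, 0], !![0, -Complex.I; Complex.I, 0], !![1, 0; 0, -1]]

/-- The Kronecker product `M 0 ⊗ M 1 ⊗ ⋯ ⊗ M (n - 1)` of `n` complex `2 × 2` matrices, a
`2 ^ n × 2 ^ n` matrix whose rows and columns are indexed by `Fin n → Fin 2`. -/
def tensor {n : ℕ} (M : Fin n → Matrix (Fin 2) (Fin 2) ℂ) :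
    Matrix (Fin n → Fin 2) (Fin n → Fin 2) ℂ :=
  Matrix.of fun s t => ∏ k, M k (s k) (t k)

/-- `I ⊗ ⋯ ⊗ I ⊗ σ⁽ᵃ⁾ ⊗ I ⊗ ⋯ ⊗ I`, with the Pauli matrix `σ⁽ᵃ⁾` in position `j`. -/
def site (n : ℕ) (a : Fin 3) (j : Fin n) : Matrix (Fin n → Fin 2) (Fin n → Fin 2) ℂ :=
  tensor (Function.update (fun _ => 1) j (pauli a))

/-- The space `ℝ^{9n}` of coefficient vectors `(x_{a,b,j})`, with the Euclidean norm. -/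
abbrev Coeff (n : ℕ) : Type := EuclideanSpace ℝ (Fin 3 × Fin 3 × Fin n)

/-- `H_n(x) = ∑_j ∑_{a,b} x_{a,b,j} σ⁽ᵃ⁾_j σ⁽ᵇ⁾_{j+1}`; `finRotate n` is the cyclic shift
`j ↦ j + 1` of the sites. -/
def hamiltonian (n : ℕ) (x : Coeff n) : Matrix (Fin n → Fin 2) (Fin n → Fin 2) ℂ :=
  ∑ j : Fin n, ∑ a : Fin 3, ∑ b : Fin 3,
    (x (a, b, j) : ℂ) • (site n a j * site n b (finRotate n j))

theorem pauli_isHermitian (a : Fin 3) : (pauli a).IsHermitian := by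
  fin_cases a <;> ext i j <;> fin_cases i <;> fin_cases j <;>
    simp [pauli, Matrix.conjTranspose_apply]

theorem tensor_mul {n : ℕ} (M N : Fin n → Matrix (Fin 2) (Fin 2) ℂ) :
    tensor M * tensor N = tensor (fun k => M k * N k) := by
  ext s t
  simp only [tensor, Matrix.mul_apply, Matrix.of_apply, ← Finset.prod_mul_distrib]
  exact (Fintype.prod_sum (fun k i => M k (s k) i * N k i (t k))).symm

theorem tensor_conjTranspose {n : ℕ} (M : Fin n → Matrix (Fin 2) (Fin 2) ℂ) :
    (tensor M).conjTranspose = tensor (fun k => (M k).conjTranspose) := by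
  ext s t
  simp [tensor, Matrix.conjTranspose_apply]

theorem site_isHermitian (n : ℕ) (a : Fin 3) (j : Fin n) : (site n a j).IsHermitian := by
  unfold Matrix.IsHermitian site
  rw [tensor_conjTranspose]
  congr 1
  funext k
  by_cases h : k = j
  · subst h; simpa using (pauli_isHermitian a).eq
  · simp [Function.update_of_ne h]

theorem site_commute {n : ℕ} (a b : Fin 3) {i j : Fin n} (h : i ≠ j) :
    Commute (site n a i) (site n b j) := by
  unfold Commute SemiconjBy site
  rw [tensor_mul, tensor_mul]
  congr 1
  funext k
  by_cases hi : k = i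
  · subst hi; simp [Function.update_of_ne h]
  · simp [Function.update_of_ne hi]

theorem finRotate_ne {n : ℕ} (hn : 2 ≤ n) (j : Fin n) : j ≠ finRotate n j := by
  have := j.neZero
  rw [finRotate_apply]
  intro h
  have h1 := congrArg Fin.val h
  have hj := j.isLt
  rw [Fin.val_add_one_of_lt'] at h1
  · omega
  · by_contra hc
    have : (j : ℕ) + 1 = n := by omega
    rw [Fin.val_add] at h1
    have e : ((1 : Fin n) : ℕ) = 1 := by
      rw [Fin.val_one', Nat.mod_eq_of_lt (by omega)]
    rw [e, this, Nat.mod_self] at h1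
    omega

theorem hamiltonian_isHermitian {n : ℕ} (hn : 2 ≤ n) (x : Coeff n) :
    (hamiltonian n x).IsHermitian := by
  unfold Matrix.IsHermitian hamiltonian
  simp only [Matrix.conjTranspose_sum, Matrix.conjTranspose_smul, Matrix.conjTranspose_mul,
    (site_isHermitian n _ _).eq]
  refine Finset.sum_congr rfl fun j _ => Finset.sum_congr rfl fun a _ =>
    Finset.sum_congr rfl fun b _ => ?_
  rw [(site_commute b a (finRotate_ne hn j).symm).eq]
  simp

/-! ### Spectral measures -/

/-- The spectral measure of a Hermitian matrix: equal mass at each eigenvalue, counted with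
multiplicity. -/
def spectralMeasure {ι : Type} [Fintype ι] [DecidableEq ι] {A : Matrix ι ι ℂ}
    (hA : A.IsHermitian) : Measure ℝ :=
  (Fintype.card ι : ℝ≥0∞)⁻¹ • ∑ i, Measure.dirac (hA.eigenvalues i)

theorem sum_eval_eigenvalues {ι : Type} [Fintype ι] [DecidableEq ι] {A : Matrix ι ι ℂ}
    (hA : A.IsHermitian) (p : Polynomial ℝ) :
    ∑ i, p.eval (hA.eigenvalues i) = ((p.map (algebraMap ℝ ℂ)).aeval A).trace.re := by
  induction p using Polynomial.induction_on' with
  | add p q hp hq => simp [Finset.sum_add_distrib, hp, hq, Matrix.trace_add]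
  | monomial k r =>
    have h : (A ^ k).trace = ∑ i, ((hA.eigenvalues i : ℂ)) ^ k := by
      conv_lhs => rw [hA.spectral_theorem, ← map_pow, Unitary.conjStarAlgAut_apply,
        Matrix.trace_mul_cycle]
      simp [Matrix.diagonal_pow, Matrix.trace_diagonal]
    simp only [Polynomial.eval_monomial, Polynomial.map_monomial, Polynomial.aeval_monomial]
    rw [← Algebra.smul_def, Matrix.trace_smul, h, ← Finset.mul_sum]
    simp [← Complex.ofReal_pow, ← Complex.ofReal_sum]

instance spectralMeasure_prob {ι : Type} [Fintype ι] [DecidableEq ι] [Nonempty ι] {A : Matrix ι ι ℂ}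
    (hA : A.IsHermitian) : IsProbabilityMeasure (spectralMeasure hA) := by
  refine ⟨?_⟩
  simp [spectralMeasure, ENNReal.inv_mul_cancel]

theorem measurable_spectralMeasure {α ι : Type} [MeasurableSpace α] [Fintype ι] [DecidableEq ι]
    [Nonempty ι] {A : α → Matrix ι ι ℂ} (hm : ∀ i j, Measurable fun x => A x i j)
    (hA : ∀ x, (A x).IsHermitian) : Measurable fun x => spectralMeasure (hA x) := by
  have hpow : ∀ k : ℕ, ∀ i j, Measurable fun x => (A x ^ k) i j := by
    intro k
    induction k with
    | zero => intro i j; simp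
    | succ k ih =>
      intro i j
      simp only [pow_succ, Matrix.mul_apply]
      exact Finset.measurable_sum _ fun l _ => (ih i l).mul (hm l j)
  have hpoly : ∀ p : Polynomial ℝ, Measurable fun x => ∑ i, p.eval ((hA x).eigenvalues i) := by
    intro p
    simp only [sum_eval_eigenvalues, Polynomial.aeval_eq_sum_range, Matrix.trace, Matrix.diag_apply,
      Matrix.sum_apply, Matrix.smul_apply, smul_eq_mul]
    refine Complex.measurable_re.comp ?_
    exact Finset.measurable_sum _ fun i _ => Finset.measurable_sum _ fun l _ =>
      (hpow l i i).const_mul _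
  have hcont : ∀ f : ℝ → ℝ, Continuous f →
      Measurable fun x => ∑ i, f ((hA x).eigenvalues i) := by
    intro f hf
    have hp : ∀ k : ℕ, ∃ p : Polynomial ℝ, ∀ y ∈ Set.Icc (-(k : ℝ)) k,
        |p.eval y - f y| < 1 / ((k : ℝ) + 1) := fun k =>
      exists_polynomial_near_of_continuousOn _ _ f hf.continuousOn _ (by positivity)
    choose p hp using hp
    have hlim : ∀ y : ℝ, Tendsto (fun k => (p k).eval y) atTop (𝓝 (f y)) := by
      intro y
      rw [tendsto_iff_dist_tendsto_zero]
      refine squeeze_zero' (Eventually.of_forall fun _ => dist_nonneg) ?_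
        (tendsto_one_div_add_atTop_nhds_zero_nat (𝕜 := ℝ))
      obtain ⟨K, hK⟩ := exists_nat_ge |y|
      filter_upwards [eventually_ge_atTop K] with k hk
      have : |y| ≤ k := hK.trans (by exact_mod_cast hk)
      exact (hp k y (by rwa [Set.mem_Icc, ← abs_le])).le
    exact measurable_of_tendsto_metrizable (fun k => hpoly (p k))
      (tendsto_pi_nhds.2 fun x => tendsto_finsetSum _ fun i _ => hlim _)
  have hind : ∀ t : ℝ, Measurable fun x =>
      ∑ i, (Set.Iic t).indicator (fun _ => (1 : ℝ)) ((hA x).eigenvalues i) := by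
    intro t
    have hlim : ∀ y : ℝ, Tendsto (fun k : ℕ => max 0 (1 - (k : ℝ) * max 0 (y - t))) atTop
        (𝓝 ((Set.Iic t).indicator (fun _ => (1 : ℝ)) y)) := by
      intro y
      rcases le_or_gt y t with h | h
      · simp [Set.indicator_of_mem (Set.mem_Iic.2 h), max_eq_left (sub_nonpos.2 h)]
      · rw [Set.indicator_of_notMem (by simpa using h)]
        refine tendsto_const_nhds.congr' ?_
        obtain ⟨K, hK⟩ := exists_nat_ge (1 / (y - t))
        filter_upwards [eventually_ge_atTop K] with k hk
        have h0 : 0 < y - t := sub_pos.2 h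
        have : 1 / (y - t) ≤ k := hK.trans (by exact_mod_cast hk)
        rw [div_le_iff₀ h0] at this
        rw [max_eq_right h0.le, max_eq_left (by linarith)]
    exact measurable_of_tendsto_metrizable
      (fun k => hcont (fun y => max 0 (1 - (k : ℝ) * max 0 (y - t))) (by fun_prop))
      (tendsto_pi_nhds.2 fun x => tendsto_finsetSum _ fun i _ => hlim _)
  refine .measure_of_isPiSystem_of_isProbabilityMeasure (borel_eq_generateFrom_Iic ℝ)
    isPiSystem_Iic ?_
  rintro _ ⟨t, rfl⟩
  have h : ∀ x, spectralMeasure (hA x) (Set.Iic t) = (Fintype.card ι : ℝ≥0∞)⁻¹ *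
      ENNReal.ofReal (∑ i, (Set.Iic t).indicator (fun _ => (1 : ℝ)) ((hA x).eigenvalues i)) := by
    intro x
    rw [ENNReal.ofReal_sum_of_nonneg fun i _ => Set.indicator_nonneg (fun _ _ => zero_le_one) _]
    simp only [spectralMeasure, Measure.smul_apply, Measure.finsetSum_apply, smul_eq_mul]
    congr 1
    refine Finset.sum_congr rfl fun i _ => ?_
    rw [Measure.dirac_apply' _ measurableSet_Iic]
    by_cases hi : (hA x).eigenvalues i ∈ Set.Iic t <;> simp [hi]
  simp only [h]
  exact ((hind t).ennreal_ofReal).const_mul _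

/-- The empirical spectral measure `μ_n` of `H_n(x)`. -/
def empirical {n : ℕ} (hn : 2 ≤ n) (x : Coeff n) : Measure ℝ :=
  spectralMeasure (hamiltonian_isHermitian hn x)

theorem measurable_empirical {n : ℕ} (hn : 2 ≤ n) : Measurable (empirical hn) := by
  refine measurable_spectralMeasure (fun s t => ?_) _
  simp only [hamiltonian, Matrix.sum_apply, Matrix.smul_apply]
  fun_prop

/-- The uniform probability measure on the unit sphere `S^{9n-1}`, as a measure on `ℝ^{9n}`. -/
def sphereLaw (n : ℕ) : Measure (Coeff n) :=
  (((volume : Measure (Coeff n)).toSphere Set.univ)⁻¹ •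
    (volume : Measure (Coeff n)).toSphere).map Subtype.val

theorem sphereLaw_prob {n : ℕ} (hn : 2 ≤ n) : IsProbabilityMeasure (sphereLaw n) := by
  have : NeZero n := ⟨by omega⟩
  have h0 : (volume : Measure (Coeff n)).toSphere Set.univ ≠ 0 := by
    rw [Ne, Measure.measure_univ_eq_zero]; exact Measure.toSphere_ne_zero _
  refine ⟨?_⟩
  rw [sphereLaw, Measure.map_apply measurable_subtype_coe .univ]
  exact ENNReal.inv_mul_cancel h0 (measure_ne_top _ _)

/-- The density of states measure, `μ_n^{DOS}(A) = 𝔼 μ_n(A)`. -/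
def dos {n : ℕ} (hn : 2 ≤ n) : Measure ℝ :=
  (sphereLaw n).bind (empirical hn)

theorem dos_prob {n : ℕ} (hn : 2 ≤ n) : IsProbabilityMeasure (dos hn) := by
  have := sphereLaw_prob hn
  refine ⟨?_⟩
  rw [dos, Measure.bind_apply .univ (measurable_empirical hn).aemeasurable]
  simp [empirical]

theorem dos_apply {n : ℕ} (hn : 2 ≤ n) {s : Set ℝ} (hs : MeasurableSet s) :
    dos hn s = ∫⁻ x, empirical hn x s ∂(sphereLaw n) :=
  Measure.bind_apply hs (measurable_empirical hn).aemeasurable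

/-! ### The bounded-Lipschitz distance -/

/-- `‖f‖_{BL} = ‖f‖_∞ + |f|_L`, with value `∞` if `f` is not bounded or not Lipschitz. -/
def blNorm (f : ℝ → ℝ) : ℝ≥0∞ :=
  (⨆ x, ‖f x‖ₑ) + ⨅ (K : ℝ≥0) (_ : LipschitzWith K f), (K : ℝ≥0∞)

/-- The bounded-Lipschitz distance between probability measures on `ℝ`. -/
def dBL (μ ν : Measure ℝ) : ℝ :=
  sSup {d : ℝ | ∃ f : ℝ → ℝ, blNorm f ≤ 1 ∧ d = |∫ x, f x ∂μ - ∫ x, f x ∂ν|}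

end

end SpinChain

/-! The Hamiltonian is linear in `x`, and the two-site Pauli products are orthogonal for the
normalized trace, apart from coincidences in pairs when `n = 2`. Hence `H(x) - H(y)` has normalized
Hilbert–Schmidt norm at most `√2 ‖x - y‖`. A Hoffman–Wielandt type coupling of spectra turns this
into a Lipschitz bound, with constant 2 for every `n`, on `x ↦ ∫ f dμ_n` for each 1-Lipschitz `f`
(`lipschitzWith_integral_empirical`). The coefficients live in dimension `9n`, so by Lévy's
inequality each such integral fluctuates by `O(n^{-1/2})`.

For the mean of `d_BL`, second moments at most 2 confine the mass to `[-R, R]` up to `O(R⁻²)`, and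
piecewise linear interpolation on `k` intervals reduces the supremum over test functions to `k`
fixed ramps (`dBL_le_sum_ramp`). The error `k/√n + R/k + 1/R²` is `O(n^{-1/6})` for `R = n^{1/12}`
and `k` about `n^{1/4}` (`integral_dBL_le`). Moreover `d_BL(μ_n, μ_n^{DOS})` is itself 2-Lipschitz
in `x`, so Lévy's inequality gives the tail bound, and Borel–Cantelli gives the almost sure bound
without any independence.

Lévy's inequality is deduced from Gaussian concentration, itself proved by the Maurey–Pisier
rotation argument: a function on the sphere is extended homogeneously, and the direction and length
of a Gaussian vector are independent. -/

/-! ### Gaussian concentration by rotation -/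

section GaussianConcentration

open Module

variable {E : Type*} [NormedAddCommGroup E] [InnerProductSpace ℝ E]

theorem norm_rotation_snd_le (θ : ℝ) (z : E × E) :
    ‖(ContinuousLinearMap.rotation θ z).2‖ ≤ ‖z.1‖ + ‖z.2‖ := by
  rw [ContinuousLinearMap.rotation_apply]
  refine (norm_add_le _ _).trans ?_
  rw [norm_smul, norm_smul, norm_neg]
  exact add_le_add (mul_le_of_le_one_left (norm_nonneg _) (Real.abs_sin_le_one _))
    (mul_le_of_le_one_left (norm_nonneg _) (Real.abs_cos_le_one _))

/-- The velocity of the rotating point is the other component of the rotated pair, so a derivative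
along the path is a function of the rotated pair alone. -/
theorem hasDerivAt_rotation_fst (θ : ℝ) (z : E × E) :
    HasDerivAt (fun θ => (ContinuousLinearMap.rotation θ z).1)
      (ContinuousLinearMap.rotation θ z).2 θ := by
  simp only [ContinuousLinearMap.rotation_apply]
  exact ((Real.hasDerivAt_cos θ).smul_const z.1).add ((Real.hasDerivAt_sin θ).smul_const z.2)

/-- The quarter turn leads from `z.1` to `z.2`. Along it `F` is Lipschitz, hence absolutely
continuous, so differentiability at almost every angle suffices for the fundamental theorem of
calculus. -/
theorem LipschitzWith.sub_eq_integral_rotation {F : E → ℝ} {K : ℝ≥0} (hF : LipschitzWith K F)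
    {z : E × E}
    (hz : ∀ᵐ θ, DifferentiableAt ℝ F (ContinuousLinearMap.rotation θ z).1) :
    F z.2 - F z.1 = ∫ θ in (0 : ℝ)..(Real.pi / 2),
      fderiv ℝ F (ContinuousLinearMap.rotation θ z).1 (ContinuousLinearMap.rotation θ z).2 := by
  have hl : LipschitzWith (‖z.1‖ + ‖z.2‖).toNNReal
      (fun θ => (ContinuousLinearMap.rotation θ z).1) := by
    refine lipschitzWith_of_nnnorm_deriv_le
      (fun θ => (hasDerivAt_rotation_fst θ z).differentiableAt) fun θ => ?_
    rw [(hasDerivAt_rotation_fst θ z).deriv, ← NNReal.coe_le_coe, coe_nnnorm,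
      Real.coe_toNNReal _ (by positivity)]
    exact norm_rotation_snd_le θ z
  have h := ((hF.comp hl).lipschitzOnWith
    (s := Set.uIcc 0 (Real.pi / 2))).absolutelyContinuousOnInterval.integral_deriv_eq_sub
  have e : (F ∘ fun θ => (ContinuousLinearMap.rotation θ z).1) (Real.pi / 2) -
      (F ∘ fun θ => (ContinuousLinearMap.rotation θ z).1) 0 = F z.2 - F z.1 := by
    simp [ContinuousLinearMap.rotation_apply]
  rw [← e, ← h]
  refine intervalIntegral.integral_congr_ae ?_
  filter_upwards [hz] with θ hθ _
  exact (hθ.hasFDerivAt.comp_hasDerivAt θ (hasDerivAt_rotation_fst θ z)).deriv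

variable [FiniteDimensional ℝ E] [MeasurableSpace E] [BorelSpace E]

/-- The density of the standard Gaussian measure on a Euclidean space. -/
theorem stdGaussian_eq_withDensity :
    stdGaussian E = (volume : Measure E).withDensity
      (fun x => ENNReal.ofReal ((2 * Real.pi) ^ (-(finrank ℝ E / 2 : ℝ)) *
        Real.exp (-(1 / 2) * ‖x‖ ^ 2))) := by
  set d : E → ℝ := fun x => (2 * Real.pi) ^ (-(finrank ℝ E / 2 : ℝ)) *
        Real.exp (-(1 / 2) * ‖x‖ ^ 2) with hd
  have hd0 : ∀ x, 0 ≤ d x := fun x => by positivity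
  have hdc : Continuous d := by fun_prop
  have hint1 : ∫ x, d x = 1 := by
    rw [hd, integral_const_mul, GaussianFourier.integral_rexp_neg_mul_sq_norm (by norm_num),
      Real.rpow_neg (by positivity), show Real.pi / (1 / 2) = 2 * Real.pi by ring]
    exact inv_mul_cancel₀ (by positivity)
  -- A non-integrable function has Bochner integral `0`, so total mass `1` forces integrability.
  have hdi : Integrable d := by
    by_contra h
    rw [integral_undef h] at hint1
    exact zero_ne_one hint1
  have : IsFiniteMeasure ((volume : Measure E).withDensity (fun x => ENNReal.ofReal (d x))) :=
    isFiniteMeasure_withDensity_ofReal hdi.2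
  refine Measure.ext_of_charFun (E := E) ?_
  ext t
  rw [charFun_stdGaussian, charFun_apply, integral_withDensity_eq_integral_toReal_smul
    (by fun_prop) (by simp)]
  have := GaussianFourier.integral_cexp_neg_mul_sq_norm_add (V := E) (b := (1 / 2 : ℂ))
    (by norm_num) Complex.I t
  have h2 : ∀ x : E, (ENNReal.ofReal (d x)).toReal • Complex.exp (inner ℝ x t * Complex.I) =
      ((2 * Real.pi) ^ (-(finrank ℝ E / 2 : ℝ)) : ℝ) *
        Complex.exp (-(1 / 2) * ‖x‖ ^ 2 + Complex.I * inner ℝ t x) := by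
    intro x
    rw [ENNReal.toReal_ofReal (hd0 x), hd, Complex.exp_add, real_inner_comm, mul_comm Complex.I,
      Complex.real_smul]
    push_cast
    ring
  rw [integral_congr_ae (ae_of_all _ h2), integral_const_mul, this]
  rw [← mul_assoc]
  have h3 : (((2 * Real.pi) ^ (-(finrank ℝ E / 2 : ℝ)) : ℝ) : ℂ) *
      ((Real.pi : ℂ) / (1 / 2)) ^ ((finrank ℝ E : ℂ) / 2) = 1 := by
    rw [show ((Real.pi : ℂ) / (1 / 2)) = ((2 * Real.pi : ℝ) : ℂ) by push_cast; ring,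
      show ((finrank ℝ E : ℂ) / 2) = ((finrank ℝ E / 2 : ℝ) : ℂ) by push_cast; ring,
      ← Complex.ofReal_cpow (by positivity), ← Complex.ofReal_mul, Real.rpow_neg (by positivity),
      inv_mul_cancel₀ (by positivity), Complex.ofReal_one]
  rw [h3, one_mul]
  congr 1
  rw [Complex.I_sq]
  ring

theorem stdGaussian_absolutelyContinuous : stdGaussian E ≪ (volume : Measure E) := by
  rw [stdGaussian_eq_withDensity]
  exact withDensity_absolutelyContinuous _ _

theorem lintegral_exp_dual_stdGaussian (L : StrongDual ℝ E) :
    ∫⁻ y, ENNReal.ofReal (Real.exp (L y)) ∂(stdGaussian E) =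
      ENNReal.ofReal (Real.exp (‖L‖ ^ 2 / 2)) := by
  have h := IsGaussian.map_eq_gaussianReal (μ := stdGaussian E) L
  rw [integral_strongDual_stdGaussian, variance_dual_stdGaussian] at h
  have h1 : ∫⁻ y, ENNReal.ofReal (Real.exp (L y)) ∂(stdGaussian E) =
      ∫⁻ y, ENNReal.ofReal (Real.exp (1 * y)) ∂((stdGaussian E).map L) := by
    rw [lintegral_map (by fun_prop) (by fun_prop)]
    simp
  rw [h1, h, ← ofReal_integral_eq_lintegral_ofReal (integrable_exp_mul_gaussianReal 1)
    (ae_of_all _ fun _ => (Real.exp_pos _).le)]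
  have h3 := congrFun (mgf_id_gaussianReal (μ := 0) (v := (‖L‖ ^ 2).toNNReal)) 1
  simp only [mgf, id] at h3
  rw [h3]
  simp

/-- Jensen's inequality for the exponential and the uniform law on `(0, a]`; the factor `a` inside
turns the integral into an average. -/
theorem exp_intervalIntegral_le {a : ℝ} (ha : 0 < a) {D : ℝ → ℝ} (hD : Measurable D) {M : ℝ}
    (hM : ∀ θ, |D θ| ≤ M) :
    ENNReal.ofReal (Real.exp (∫ θ in (0 : ℝ)..a, D θ)) ≤
      ENNReal.ofReal a⁻¹ * ∫⁻ θ in Set.Ioc 0 a, ENNReal.ofReal (Real.exp (a * D θ)) := by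
  have hfin : volume (Set.Ioc 0 a) ≠ ∞ := by simp
  have hi1 : IntegrableOn (fun θ => a * D θ) (Set.Ioc 0 a) :=
    Measure.integrableOn_of_bounded (M := a * M) hfin (by fun_prop)
      (ae_of_all _ fun θ => by
        rw [Real.norm_eq_abs, abs_mul, abs_of_pos ha]; exact mul_le_mul_of_nonneg_left (hM θ) ha.le)
  have hi2 : IntegrableOn (Real.exp ∘ fun θ => a * D θ) (Set.Ioc 0 a) :=
    Measure.integrableOn_of_bounded (M := Real.exp (a * M)) hfin (by fun_prop)
      (ae_of_all _ fun θ => by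
        rw [Real.norm_eq_abs, Function.comp, Real.abs_exp, Real.exp_le_exp]
        exact mul_le_mul_of_nonneg_left ((le_abs_self _).trans (hM θ)) ha.le)
  have h := convexOn_exp.map_set_average_le Real.continuous_exp.continuousOn isClosed_univ
    (by simp [ha]) hfin (by simp) hi1 hi2
  rw [setAverage_eq, setAverage_eq, integral_const_mul] at h
  simp only [measureReal_def, Real.volume_Ioc, sub_zero, ENNReal.toReal_ofReal ha.le,
    smul_eq_mul] at h
  rw [inv_mul_cancel_left₀ ha.ne'] at h
  rw [intervalIntegral.integral_of_le ha.le]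
  refine (ENNReal.ofReal_le_ofReal h).trans ?_
  rw [ENNReal.ofReal_mul (by positivity)]
  gcongr
  exact (ofReal_integral_eq_lintegral_ofReal hi2 (ae_of_all _ fun _ => (Real.exp_pos _).le)).le

theorem measurable_fderiv_apply (F : E → ℝ) :
    Measurable fun p : E × E => fderiv ℝ F p.1 p.2 :=
  isBoundedBilinearMap_apply.continuous.measurable.comp
    (((measurable_fderiv ℝ F).comp measurable_fst).prodMk measurable_snd)

theorem measurable_rotation : Measurable fun p : ℝ × (E × E) =>
    ContinuousLinearMap.rotation p.1 p.2 := by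
  simp only [ContinuousLinearMap.rotation_apply]
  fun_prop

theorem lintegral_comp_rotation_stdGaussian (θ : ℝ) {f : E × E → ℝ≥0∞} (hf : Measurable f) :
    ∫⁻ z, f (ContinuousLinearMap.rotation θ z) ∂((stdGaussian E).prod (stdGaussian E)) =
      ∫⁻ z, f z ∂((stdGaussian E).prod (stdGaussian E)) := by
  have h := IsGaussian.map_rotation_eq_self (μ := stdGaussian E) integral_id_stdGaussian θ
  conv_rhs => rw [← h]
  rw [lintegral_map hf (by fun_prop)]

/-- For a fixed angle this is Rademacher's theorem and rotation invariance of the Gaussian pair;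
Fubini exchanges the quantifiers. -/
theorem LipschitzWith.ae_ae_differentiableAt_rotation {F : E → ℝ} {K : ℝ≥0}
    (hF : LipschitzWith K F) :
    ∀ᵐ z ∂((stdGaussian E).prod (stdGaussian E)), ∀ᵐ θ : ℝ,
      DifferentiableAt ℝ F (ContinuousLinearMap.rotation θ z).1 := by
  have hmeas : MeasurableSet {x | DifferentiableAt ℝ F x} := measurableSet_of_differentiableAt ℝ F
  rw [Measure.ae_ae_comm]
  · refine ae_of_all _ fun θ => ?_
    have h := IsGaussian.map_rotation_eq_self (μ := stdGaussian E) integral_id_stdGaussian θ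
    have h1 : ∀ᵐ z ∂((stdGaussian E).prod (stdGaussian E)), DifferentiableAt ℝ F z.1 :=
      Measure.quasiMeasurePreserving_fst.ae
        (stdGaussian_absolutelyContinuous.ae_le hF.ae_differentiableAt)
    rw [← h] at h1
    exact ae_of_ae_map (ContinuousLinearMap.rotation θ).continuous.aemeasurable h1
  · exact ((measurable_fst.comp (measurable_rotation (E := E))).comp measurable_swap) hmeas

theorem lintegral_lintegral_rotation_stdGaussian {f : E × E → ℝ≥0∞} (hf : Measurable f) {a : ℝ}
    (ha : 0 < a) :
    ∫⁻ z, ENNReal.ofReal a⁻¹ * (∫⁻ θ : ℝ in Set.Ioc 0 a, f (ContinuousLinearMap.rotation θ z))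
      ∂((stdGaussian E).prod (stdGaussian E)) =
      ∫⁻ z, f z ∂((stdGaussian E).prod (stdGaussian E)) := by
  have hm := (hf.comp (measurable_rotation (E := E))).comp (measurable_swap (α := E × E) (β := ℝ))
  rw [lintegral_const_mul' _ _ (by simp),
    lintegral_lintegral_swap (f := fun z θ => f (ContinuousLinearMap.rotation θ z))
      hm.aemeasurable]
  simp_rw [lintegral_comp_rotation_stdGaussian _ hf]
  rw [lintegral_const, Measure.restrict_apply_univ, Real.volume_Ioc, sub_zero, mul_left_comm,
    ← ENNReal.ofReal_mul (by positivity), inv_mul_cancel₀ ha.ne', ENNReal.ofReal_one, mul_one]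

/-- With `z.1` fixed, the exponent is a linear form of norm at most `a K` in the independent
Gaussian `z.2`. -/
theorem LipschitzWith.lintegral_exp_fderiv_stdGaussian_le {F : E → ℝ} {K : ℝ≥0}
    (hF : LipschitzWith K F) {a : ℝ} (ha : 0 < a) :
    ∫⁻ z : E × E, ENNReal.ofReal (Real.exp (a * fderiv ℝ F z.1 z.2))
        ∂((stdGaussian E).prod (stdGaussian E)) ≤
      ENNReal.ofReal (Real.exp (a ^ 2 * K ^ 2 / 2)) := by
  have hm : Measurable fun p : E × E => ENNReal.ofReal (Real.exp (a * fderiv ℝ F p.1 p.2)) :=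
    ((measurable_fderiv_apply F).const_mul _).exp.ennreal_ofReal
  rw [lintegral_prod _ hm.aemeasurable]
  refine (lintegral_mono fun x => ?_).trans_eq (by rw [lintegral_const, measure_univ, mul_one])
  have := lintegral_exp_dual_stdGaussian (a • fderiv ℝ F x)
  simp only [smul_apply, smul_eq_mul] at this
  rw [this]
  refine ENNReal.ofReal_le_ofReal (Real.exp_le_exp.2 ?_)
  rw [norm_smul, Real.norm_eq_abs, abs_of_pos ha, mul_pow]
  have := norm_fderiv_le_of_lipschitz ℝ hF (x₀ := x)
  gcongr

theorem LipschitzWith.lintegral_exp_sub_stdGaussian_le {F : E → ℝ} {K : ℝ≥0}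
    (hF : LipschitzWith K F) :
    ∫⁻ z, ENNReal.ofReal (Real.exp (F z.2 - F z.1)) ∂((stdGaussian E).prod (stdGaussian E)) ≤
      ENNReal.ofReal (Real.exp ((Real.pi / 2) ^ 2 * K ^ 2 / 2)) := by
  have hpi : 0 < Real.pi / 2 := by positivity
  have hm : Measurable fun p : E × E =>
      ENNReal.ofReal (Real.exp (Real.pi / 2 * fderiv ℝ F p.1 p.2)) :=
    ((measurable_fderiv_apply F).const_mul _).exp.ennreal_ofReal
  refine le_trans ?_ (hF.lintegral_exp_fderiv_stdGaussian_le hpi)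
  rw [← lintegral_lintegral_rotation_stdGaussian hm hpi]
  refine lintegral_mono_ae ?_
  filter_upwards [hF.ae_ae_differentiableAt_rotation] with z hz
  rw [hF.sub_eq_integral_rotation hz]
  have hD : Measurable fun θ : ℝ => fderiv ℝ F (ContinuousLinearMap.rotation θ z).1
      (ContinuousLinearMap.rotation θ z).2 := by
    have h1 : Measurable fun θ : ℝ => ContinuousLinearMap.rotation θ z := by
      simp only [ContinuousLinearMap.rotation_apply]
      fun_prop
    exact (measurable_fderiv_apply F).comp h1
  refine exp_intervalIntegral_le hpi hD (M := K * (‖z.1‖ + ‖z.2‖)) fun θ => ?_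
  rw [← Real.norm_eq_abs]
  refine ((fderiv ℝ F (ContinuousLinearMap.rotation θ z).1).le_opNorm _).trans ?_
  have := norm_fderiv_le_of_lipschitz ℝ hF (x₀ := (ContinuousLinearMap.rotation θ z).1)
  have := norm_rotation_snd_le θ z
  gcongr

theorem LipschitzWith.integrable_stdGaussian {F : E → ℝ} {K : ℝ≥0} (hF : LipschitzWith K F) :
    Integrable F (stdGaussian E) := by
  have h : Integrable (fun x : E => |F 0| + K * ‖x‖) (stdGaussian E) :=
    (integrable_const _).add (IsGaussian.integrable_id.norm.const_mul _)
  refine h.mono' hF.continuous.aestronglyMeasurable (ae_of_all _ fun x => ?_)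
  have := hF.norm_sub_le x 0
  rw [sub_zero] at this
  have h2 := norm_sub_norm_le (F x) (F 0)
  rw [Real.norm_eq_abs (F 0)] at h2
  linarith

/-- By independence the bound for `F z.2 - F z.1` factors, and the factor from `-F z.1` is at least
1 because `F` is centred. -/
theorem LipschitzWith.lintegral_exp_stdGaussian_le {F : E → ℝ} {K : ℝ≥0}
    (hF : LipschitzWith K F) (h0 : ∫ x, F x ∂(stdGaussian E) = 0) :
    ∫⁻ x, ENNReal.ofReal (Real.exp (F x)) ∂(stdGaussian E) ≤
      ENNReal.ofReal (Real.exp ((Real.pi / 2) ^ 2 * K ^ 2 / 2)) := by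
  set γ := stdGaussian E
  have hFm : Measurable F := hF.continuous.measurable
  have hFi : Integrable F γ := hF.integrable_stdGaussian
  have h1 : 1 ≤ ∫⁻ x, ENNReal.ofReal (Real.exp (-F x)) ∂γ := by
    calc (1 : ℝ≥0∞) = ENNReal.ofReal (∫ x, (1 - F x) ∂γ) := by
          rw [integral_sub (integrable_const _) hFi, h0]; simp
      _ ≤ ∫⁻ x, ENNReal.ofReal (1 - F x) ∂γ := by
          have hi : Integrable (fun x => 1 - F x) γ := (integrable_const _).sub hFi
          rw [integral_eq_lintegral_pos_part_sub_lintegral_neg_part hi]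
          refine (ENNReal.ofReal_le_ofReal (sub_le_self _ ENNReal.toReal_nonneg)).trans
            ENNReal.ofReal_toReal_le
      _ ≤ _ := by
          gcongr with x
          linarith [Real.add_one_le_exp (-F x)]
  have h2 := hF.lintegral_exp_sub_stdGaussian_le
  have h3 : ∫⁻ z, ENNReal.ofReal (Real.exp (F z.2 - F z.1)) ∂(γ.prod γ) =
      (∫⁻ x, ENNReal.ofReal (Real.exp (-F x)) ∂γ) * ∫⁻ x, ENNReal.ofReal (Real.exp (F x)) ∂γ := by
    rw [← lintegral_prod_mul (by fun_prop) (by fun_prop)]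
    refine lintegral_congr fun z => ?_
    rw [← ENNReal.ofReal_mul (Real.exp_pos _).le, ← Real.exp_add]
    ring_nf
  rw [h3] at h2
  exact (le_mul_of_one_le_left' h1).trans h2

/-- **Gaussian concentration**: a centred Lipschitz function of a standard Gaussian vector is
sub-Gaussian. -/
theorem LipschitzWith.hasSubgaussianMGF_stdGaussian {F : E → ℝ} {K : ℝ≥0}
    (hF : LipschitzWith K F) (h0 : ∫ x, F x ∂(stdGaussian E) = 0) :
    HasSubgaussianMGF F ((3 * K) ^ 2) (stdGaussian E) := by
  have key : ∀ t : ℝ, ∫⁻ x, ENNReal.ofReal (Real.exp (t * F x)) ∂(stdGaussian E) ≤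
      ENNReal.ofReal (Real.exp (((3 * K) ^ 2 : ℝ≥0) * t ^ 2 / 2)) := by
    intro t
    have hl : LipschitzWith (‖t‖₊ * K) fun x => t * F x := by
      have := (lipschitzWith_smul t).comp hF
      simpa [Function.comp_def] using this
    refine (hl.lintegral_exp_stdGaussian_le (by rw [integral_const_mul, h0, mul_zero])).trans ?_
    refine ENNReal.ofReal_le_ofReal (Real.exp_le_exp.2 ?_)
    -- Only `(π/2)² ≤ 4` is used; the `9` from `(3K)²` leaves room.
    have hpi : Real.pi ^ 2 ≤ 16 := by nlinarith [Real.pi_le_four, Real.pi_pos]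
    push_cast
    rw [Real.norm_eq_abs, mul_pow, sq_abs]
    nlinarith [mul_nonneg (sq_nonneg t) (sq_nonneg (K : ℝ))]
  have hm : Measurable F := hF.continuous.measurable
  have hi : ∀ t : ℝ, Integrable (fun x => Real.exp (t * F x)) (stdGaussian E) := fun t => by
    refine ⟨by fun_prop, ?_⟩
    rw [hasFiniteIntegral_iff_ofReal (ae_of_all _ fun _ => (Real.exp_pos _).le)]
    exact (key t).trans_lt ENNReal.ofReal_lt_top
  refine ⟨hi, fun t => ?_⟩
  rw [← ENNReal.ofReal_le_ofReal_iff (Real.exp_pos _).le, mgf,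
    ofReal_integral_eq_lintegral_ofReal (hi t) (ae_of_all _ fun _ => (Real.exp_pos _).le)]
  exact key t

end GaussianConcentration

/-! ### Lévy's inequality on the sphere -/

section SphereConcentration

open Module

variable {E : Type*} [NormedAddCommGroup E] [InnerProductSpace ℝ E]

/-- The weight `‖x‖` compensates for the blow-up of normalization near the origin. -/
theorem norm_mul_norm_normalize_sub_le (x y : E) (hy : y ≠ 0) :
    ‖x‖ * ‖‖x‖⁻¹ • x - ‖y‖⁻¹ • y‖ ≤ 2 * ‖x - y‖ := by
  have hy' : ‖y‖ ≠ 0 := norm_ne_zero_iff.2 hy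
  rcases eq_or_ne x 0 with rfl | hx
  · simp
  have hx' : ‖x‖ ≠ 0 := norm_ne_zero_iff.2 hx
  have e : ‖x‖ • (‖x‖⁻¹ • x - ‖y‖⁻¹ • y) = (x - y) + (‖y‖ - ‖x‖) • (‖y‖⁻¹ • y) := by
    rw [smul_sub, smul_inv_smul₀ hx', sub_smul, smul_inv_smul₀ hy']
    abel
  calc ‖x‖ * ‖‖x‖⁻¹ • x - ‖y‖⁻¹ • y‖ = ‖‖x‖ • (‖x‖⁻¹ • x - ‖y‖⁻¹ • y)‖ := by
        rw [norm_smul, norm_norm]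
    _ ≤ ‖x - y‖ + ‖(‖y‖ - ‖x‖) • (‖y‖⁻¹ • y)‖ := by rw [e]; exact norm_add_le _ _
    _ = ‖x - y‖ + |‖y‖ - ‖x‖| := by
        rw [norm_smul, norm_smul, norm_inv, norm_norm, inv_mul_cancel₀ hy', mul_one,
          Real.norm_eq_abs]
    _ ≤ 2 * ‖x - y‖ := by
        rw [abs_sub_comm]
        linarith [abs_norm_sub_norm_le x y]

/-- Equality fails at the origin, whose normalization is `0`; this is why later bounds are asked on
the whole unit ball. -/
theorem norm_normalize_le_one (x : E) : ‖‖x‖⁻¹ • x‖ ≤ 1 := by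
  rw [norm_smul, norm_inv, norm_norm]
  exact inv_mul_le_one

/-- The positively homogeneous extension of a Lipschitz function with controlled values on the
unit ball is Lipschitz. -/
theorem LipschitzWith.norm_mul_normalize {F : E → ℝ} {K : ℝ≥0} (hF : LipschitzWith K F) {m : ℝ}
    (hm : ∀ u, ‖u‖ ≤ 1 → |F u - m| ≤ 2 * K) :
    LipschitzWith (4 * K) fun x => ‖x‖ * (F (‖x‖⁻¹ • x) - m) := by
  refine LipschitzWith.of_le_add_mul _ fun x y => ?_
  rw [dist_eq_norm]
  push_cast
  have hK : (0 : ℝ) ≤ K := K.2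
  rcases eq_or_ne y 0 with rfl | hy
  · have := (abs_le.1 (hm _ (norm_normalize_le_one x))).2
    simp only [norm_zero, zero_mul, sub_zero, zero_add]
    nlinarith [mul_le_mul_of_nonneg_left this (norm_nonneg x), mul_nonneg hK (norm_nonneg x)]
  · have h1 := (le_abs_self _).trans (hF.norm_sub_le (‖x‖⁻¹ • x) (‖y‖⁻¹ • y))
    have h2 := mul_le_mul_of_nonneg_left h1 (norm_nonneg x)
    have h3 := mul_le_mul_of_nonneg_left (norm_mul_norm_normalize_sub_le x y hy) hK
    have h4 : (‖x‖ - ‖y‖) * (F (‖y‖⁻¹ • y) - m) ≤ ‖x - y‖ * (2 * K) := by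
      refine (le_abs_self _).trans ?_
      rw [abs_mul]
      exact mul_le_mul (abs_norm_sub_norm_le x y) (hm _ (norm_normalize_le_one y)) (abs_nonneg _)
        (norm_nonneg _)
    nlinarith

variable [FiniteDimensional ℝ E] [MeasurableSpace E] [BorelSpace E]

variable (E) in
/-- The uniform probability measure on the unit sphere, as a measure on the ambient space. -/
noncomputable def unitSphereLaw : Measure E :=
  (((volume : Measure E).toSphere Set.univ)⁻¹ • (volume : Measure E).toSphere).map Subtype.val

instance isProbabilityMeasure_unitSphereLaw [Nontrivial E] :
    IsProbabilityMeasure (unitSphereLaw E) := by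
  have h0 : (volume : Measure E).toSphere Set.univ ≠ 0 := by
    rw [Ne, Measure.measure_univ_eq_zero]; exact Measure.toSphere_ne_zero _
  refine ⟨?_⟩
  rw [unitSphereLaw, Measure.map_apply measurable_subtype_coe .univ]
  exact ENNReal.inv_mul_cancel h0 (measure_ne_top _ _)

theorem ae_unitSphereLaw_norm_eq_one : ∀ᵐ x ∂(unitSphereLaw E), ‖x‖ = 1 := by
  rw [unitSphereLaw, ae_map_iff measurable_subtype_coe.aemeasurable
    (measurableSet_eq_fun measurable_norm measurable_const)]
  exact ae_of_all _ fun x => by simp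

/-- Polar coordinates, the origin being a null set. -/
theorem lintegral_normalize_mul_norm [Nontrivial E] {f : E → ℝ≥0∞} {g : ℝ → ℝ≥0∞}
    (hf : Measurable f) (hg : Measurable g) :
    ∫⁻ x, f (‖x‖⁻¹ • x) * g ‖x‖ ∂(volume : Measure E) =
      (∫⁻ u, f u ∂(volume : Measure E).toSphere) *
        ∫⁻ r, g r ∂(Measure.volumeIoiPow (finrank ℝ E - 1)) := by
  have hmp := (volume : Measure E).measurePreserving_homeomorphUnitSphereProd
  rw [← lintegral_prod_mul (by fun_prop) (by fun_prop), ← hmp.map_eq,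
    lintegral_map (by fun_prop) (Homeomorph.measurable _)]
  conv_lhs => rw [← restrict_compl_singleton (μ := (volume : Measure E)) 0,
    ← lintegral_subtype_comap (measurableSet_singleton _).compl]
  refine lintegral_congr fun x => ?_
  simp only [homeomorphUnitSphereProd_apply_fst_coe, homeomorphUnitSphereProd_apply_snd_coe]

/-- The Gaussian density is radial, so it joins the radial factor. Taking `f = 1` identifies that
factor without computing it. -/
theorem lintegral_normalize_mul_norm_stdGaussian [Nontrivial E] {f : E → ℝ≥0∞} {g : ℝ → ℝ≥0∞}
    (hf : Measurable f) (hg : Measurable g) :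
    ∫⁻ x, f (‖x‖⁻¹ • x) * g ‖x‖ ∂(stdGaussian E) =
      (∫⁻ u, f u ∂(unitSphereLaw E)) * ∫⁻ x, g ‖x‖ ∂(stdGaussian E) := by
  set D : ℝ → ℝ≥0∞ := fun r => ENNReal.ofReal ((2 * Real.pi) ^ (-(finrank ℝ E / 2 : ℝ)) *
        Real.exp (-(1 / 2) * r ^ 2)) with hD
  have hDm : Measurable D := by fun_prop
  have key : ∀ f : E → ℝ≥0∞, Measurable f → ∫⁻ x, f (‖x‖⁻¹ • x) * g ‖x‖ ∂(stdGaussian E) =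
      (∫⁻ u, f u ∂(volume : Measure E).toSphere) *
        ∫⁻ r, D r * g r ∂(Measure.volumeIoiPow (finrank ℝ E - 1)) := by
    intro f hf
    have hγ : stdGaussian E = (volume : Measure E).withDensity (D ∘ norm) :=
      stdGaussian_eq_withDensity
    rw [hγ, lintegral_withDensity_eq_lintegral_mul _ (hDm.comp measurable_norm)
      (g := fun x => f (‖x‖⁻¹ • x) * g ‖x‖) (by fun_prop),
      ← lintegral_normalize_mul_norm (g := fun r => D r * g r) hf (by fun_prop)]
    refine lintegral_congr fun x => ?_
    simp only [Pi.mul_apply, Function.comp]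
    ring
  have h1 := key (fun _ => 1) measurable_const
  simp only [one_mul, lintegral_const] at h1
  have h0 : (volume : Measure E).toSphere Set.univ ≠ 0 := by
    rw [Ne, Measure.measure_univ_eq_zero]; exact Measure.toSphere_ne_zero _
  rw [h1, key f hf, unitSphereLaw, lintegral_map hf measurable_subtype_coe,
    lintegral_smul_measure, smul_eq_mul, ← mul_assoc, mul_right_comm _ _ (Measure.toSphere _ _),
    ENNReal.inv_mul_cancel h0 (measure_ne_top _ _), one_mul]

/-- Independence of direction and length, obtained from indicator functions. -/
theorem map_normalize_norm_stdGaussian [Nontrivial E] :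
    (stdGaussian E).map (fun x => (‖x‖⁻¹ • x, ‖x‖)) =
      (unitSphereLaw E).prod ((stdGaussian E).map norm) := by
  have : IsProbabilityMeasure ((stdGaussian E).map norm) :=
    Measure.isProbabilityMeasure_map measurable_norm.aemeasurable
  refine (Measure.prod_eq fun s t hs ht => ?_).symm
  have h := lintegral_normalize_mul_norm_stdGaussian (E := E)
    (measurable_const.indicator hs : Measurable (s.indicator fun _ => (1 : ℝ≥0∞)))
    (measurable_const.indicator ht : Measurable (t.indicator fun _ => (1 : ℝ≥0∞)))
  have e : (fun x : E => s.indicator (fun _ => (1 : ℝ≥0∞)) (‖x‖⁻¹ • x) *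
      t.indicator (fun _ => (1 : ℝ≥0∞)) ‖x‖) =
      ((fun x : E => (‖x‖⁻¹ • x, ‖x‖)) ⁻¹' s ×ˢ t).indicator fun _ => 1 := by
    ext x
    by_cases h1 : ‖x‖⁻¹ • x ∈ s <;> by_cases h2 : ‖x‖ ∈ t <;> simp [h1, h2]
  have e2 : (fun x : E => t.indicator (fun _ => (1 : ℝ≥0∞)) ‖x‖) =
      (norm ⁻¹' t).indicator fun _ => 1 := rfl
  have hm : Measurable (fun x : E => (‖x‖⁻¹ • x, ‖x‖)) := by fun_prop
  rw [e, e2, lintegral_indicator_const (hm (hs.prod ht)), lintegral_indicator_const hs,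
    lintegral_indicator_const (measurable_norm ht), one_mul, one_mul, one_mul] at h
  rw [Measure.map_apply hm (hs.prod ht), Measure.map_apply measurable_norm ht, h]

theorem integral_norm_mul_normalize_stdGaussian [Nontrivial E] {f : E → ℝ}
    (hf : Measurable f) :
    ∫ x, ‖x‖ * f (‖x‖⁻¹ • x) ∂(stdGaussian E) =
      (∫ x, ‖x‖ ∂(stdGaussian E)) * ∫ u, f u ∂(unitSphereLaw E) := by
  have hm : Measurable (fun x : E => (‖x‖⁻¹ • x, ‖x‖)) := by fun_prop
  have h : ∫ p, f p.1 * p.2 ∂((stdGaussian E).map (fun x => (‖x‖⁻¹ • x, ‖x‖))) =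
      ∫ x, ‖x‖ * f (‖x‖⁻¹ • x) ∂(stdGaussian E) := by
    rw [integral_map hm.aemeasurable (by fun_prop)]
    simp only [mul_comm]
  rw [← h, map_normalize_norm_stdGaussian, integral_prod_mul f (fun r => r),
    integral_map measurable_norm.aemeasurable (by fun_prop), mul_comm]

theorem map_normalize_stdGaussian [Nontrivial E] :
    (stdGaussian E).map (fun x => ‖x‖⁻¹ • x) = unitSphereLaw E := by
  have : IsProbabilityMeasure ((stdGaussian E).map norm) :=
    Measure.isProbabilityMeasure_map measurable_norm.aemeasurable
  have h := congrArg (Measure.map Prod.fst) (map_normalize_norm_stdGaussian (E := E))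
  rw [Measure.map_map measurable_fst (by fun_prop), Measure.map_fst_prod, measure_univ,
    one_smul] at h
  exact h

theorem integral_exp_neg_sq_norm_stdGaussian :
    ∫ x, Real.exp (-‖x‖ ^ 2) ∂(stdGaussian E) = (3 : ℝ) ^ (-(finrank ℝ E / 2 : ℝ)) := by
  rw [stdGaussian_eq_withDensity, integral_withDensity_eq_integral_toReal_smul (by fun_prop)
    (by simp)]
  have h : ∀ x : E, (ENNReal.ofReal ((2 * Real.pi) ^ (-(finrank ℝ E / 2 : ℝ)) *
      Real.exp (-(1 / 2) * ‖x‖ ^ 2))).toReal • Real.exp (-‖x‖ ^ 2) =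
      (2 * Real.pi) ^ (-(finrank ℝ E / 2 : ℝ)) * Real.exp (-(3 / 2) * ‖x‖ ^ 2) := by
    intro x
    rw [ENNReal.toReal_ofReal (by positivity), smul_eq_mul, mul_assoc, ← Real.exp_add]
    ring_nf
  rw [integral_congr_ae (ae_of_all _ h), integral_const_mul,
    GaussianFourier.integral_rexp_neg_mul_sq_norm (by norm_num), Real.rpow_neg (by positivity),
    Real.rpow_neg (by positivity), ← Real.inv_rpow (by positivity), ← Real.mul_rpow (by positivity)
    (by positivity), ← Real.inv_rpow (by positivity)]
  congr 1
  have := Real.pi_ne_zero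
  field_simp

/-- Markov's inequality for `exp (-‖x‖²)`. With `log 3 ≥ 2/3` the exponent is at most `N/4 - N/3 =
-N/12`. -/
theorem stdGaussian_norm_sq_le_le :
    (stdGaussian E).real {x | ‖x‖ ^ 2 ≤ finrank ℝ E / 4} ≤ Real.exp (-(finrank ℝ E / 80 : ℝ)) := by
  set N : ℝ := (finrank ℝ E : ℝ)
  have hN : 0 ≤ N := Nat.cast_nonneg _
  have hi : Integrable (fun x : E => Real.exp (-‖x‖ ^ 2)) (stdGaussian E) :=
    (integrable_const (1 : ℝ)).mono' (by fun_prop) (ae_of_all _ fun x => by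
      rw [Real.norm_eq_abs, Real.abs_exp]
      exact Real.exp_le_one_iff.2 (by simp))
  have h := mul_meas_ge_le_integral_of_nonneg (ae_of_all _ fun x => (Real.exp_pos _).le) hi
    (Real.exp (-(N / 4)))
  rw [integral_exp_neg_sq_norm_stdGaussian] at h
  have e : {x : E | Real.exp (-(N / 4)) ≤ Real.exp (-‖x‖ ^ 2)} = {x | ‖x‖ ^ 2 ≤ N / 4} := by
    ext x; simp [Real.exp_le_exp]
  rw [e] at h
  have h3 : (3 : ℝ) ^ (-(N / 2)) ≤ Real.exp (-(N / 4)) * Real.exp (-(N / 80)) := by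
    rw [Real.rpow_def_of_pos (by norm_num), ← Real.exp_add, Real.exp_le_exp]
    have := Real.one_sub_inv_le_log_of_pos (show (0 : ℝ) < 3 by norm_num)
    norm_num at this
    nlinarith
  exact le_of_mul_le_mul_left (h.trans h3) (Real.exp_pos _)

variable {F : E → ℝ} {K : ℝ≥0}

theorem LipschitzWith.integrable_unitSphereLaw [Nontrivial E] (hF : LipschitzWith K F) :
    Integrable F (unitSphereLaw E) := by
  refine (integrable_const (|F 0| + K)).mono' hF.continuous.aestronglyMeasurable ?_
  filter_upwards [ae_unitSphereLaw_norm_eq_one (E := E)] with x hx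
  have := hF.norm_sub_le x 0
  rw [sub_zero, hx, mul_one] at this
  have h2 := norm_sub_norm_le (F x) (F 0)
  rw [Real.norm_eq_abs (F 0)] at h2
  linarith

theorem LipschitzWith.abs_sub_integral_unitSphereLaw_le [Nontrivial E] (hF : LipschitzWith K F)
    {u : E} (hu : ‖u‖ ≤ 1) : |F u - ∫ v, F v ∂(unitSphereLaw E)| ≤ 2 * K := by
  have hi := hF.integrable_unitSphereLaw
  have e : F u - ∫ v, F v ∂(unitSphereLaw E) = ∫ v, (F u - F v) ∂(unitSphereLaw E) := by
    rw [integral_sub (integrable_const _) hi]; simp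
  rw [e, ← Real.norm_eq_abs]
  refine (norm_integral_le_of_norm_le_const (C := 2 * K) ?_).trans (by simp)
  filter_upwards [ae_unitSphereLaw_norm_eq_one (E := E)] with v hv
  refine (hF.norm_sub_le u v).trans ?_
  rw [mul_comm]
  gcongr
  exact (_root_.norm_sub_le _ _).trans (by linarith)

/-- **Lévy's concentration inequality on the sphere**: a `K`-Lipschitz function exceeds its mean by
`t` with probability at most `2 exp (-N t² / (1152 K²))`, where `N` is the dimension of the ambient
space. -/
theorem LipschitzWith.unitSphereLaw_mean_add_le_le [Nontrivial E] (hF : LipschitzWith K F)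
    (hK : 0 < K) {t : ℝ} (ht : 0 ≤ t) :
    (unitSphereLaw E).real {x | ∫ v, F v ∂(unitSphereLaw E) + t ≤ F x} ≤
      2 * Real.exp (-(finrank ℝ E * t ^ 2 / (1152 * K ^ 2))) := by
  set m := ∫ v, F v ∂(unitSphereLaw E) with hm
  set N : ℝ := (finrank ℝ E : ℝ) with hNdef
  have hN : 0 < N := Nat.cast_pos.2 finrank_pos
  have hK' : (0 : ℝ) < K := hK
  have hFm : Measurable F := hF.continuous.measurable
  -- Deviations above `2K`, the diameter bound, almost surely do not occur.
  rcases lt_or_ge (2 * K : ℝ) t with hlt | hle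
  · have h0 : (unitSphereLaw E).real {x | m + t ≤ F x} = 0 := by
      rw [measureReal_eq_zero_iff, ← compl_compl {x | m + t ≤ F x}, ← mem_ae_iff]
      filter_upwards [ae_unitSphereLaw_norm_eq_one (E := E)] with x hx
      have := (abs_le.1 (hF.abs_sub_integral_unitSphereLaw_le hx.le)).2
      simp only [Set.mem_compl_iff, Set.mem_ofPred_eq, not_le]
      linarith
    rw [h0]; positivity
  set G : E → ℝ := fun x => ‖x‖ * (F (‖x‖⁻¹ • x) - m) with hG
  have hGl : LipschitzWith (4 * K) G :=
    hF.norm_mul_normalize fun u hu => hF.abs_sub_integral_unitSphereLaw_le hu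
  have hG0 : ∫ x, G x ∂(stdGaussian E) = 0 := by
    rw [hG, integral_norm_mul_normalize_stdGaussian (f := fun u => F u - m) (by fun_prop),
      integral_sub hF.integrable_unitSphereLaw (integrable_const _)]
    simp [← hm]
  have hmeas : MeasurableSet {x | m + t ≤ F x} := measurableSet_le measurable_const hFm
  have h1 : (unitSphereLaw E).real {x | m + t ≤ F x} =
      (stdGaussian E).real {x | m + t ≤ F (‖x‖⁻¹ • x)} := by
    rw [← map_normalize_stdGaussian, map_measureReal_apply (by fun_prop) hmeas]
    rfl
  -- Either the Gaussian vector is unusually short, or a deviation of `F` is magnified by a length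
  -- of at least `√N / 2` in `G`.
  have hsub : {x : E | m + t ≤ F (‖x‖⁻¹ • x)} ⊆
      {x | ‖x‖ ^ 2 ≤ N / 4} ∪ {x | t * √N / 2 ≤ G x} := by
    intro x hx
    simp only [Set.mem_ofPred_eq] at hx
    rcases le_or_gt (‖x‖ ^ 2) (N / 4) with h | h
    · exact Or.inl h
    · refine Or.inr ?_
      have h2 : √N / 2 ≤ ‖x‖ := by
        rw [show √N / 2 = √(N / 4) by
          rw [Real.sqrt_div' _ (by norm_num), show (4 : ℝ) = 2 ^ 2 by norm_num,
            Real.sqrt_sq (by norm_num)]]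
        exact Real.sqrt_le_iff.2 ⟨norm_nonneg _, h.le⟩
      simp only [Set.mem_ofPred_eq, hG]
      calc t * √N / 2 = √N / 2 * t := by ring
        _ ≤ ‖x‖ * (F (‖x‖⁻¹ • x) - m) := by gcongr; linarith
  rw [h1]
  refine (measureReal_mono hsub).trans ((measureReal_union_le _ _).trans ?_)
  rw [two_mul]
  -- As `t ≤ 2K`, the target exponent is at most `N/288`, below `N/80`. For `G` the variance proxy
  -- is `(12K)²` and the threshold `t√N/2`, whence `1152 = 8 · 144`.
  refine add_le_add (stdGaussian_norm_sq_le_le.trans ?_)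
    (((hGl.hasSubgaussianMGF_stdGaussian hG0).measure_ge_le (by positivity)).trans_eq ?_)
  · rw [Real.exp_le_exp, neg_le_neg_iff, div_le_div_iff₀ (by positivity) (by norm_num)]
    have : t ^ 2 ≤ (2 * K) ^ 2 := pow_le_pow_left₀ ht hle 2
    nlinarith
  · congr 1
    push_cast
    rw [div_pow, mul_pow, Real.sq_sqrt hN.le]
    field_simp
    ring

theorem LipschitzWith.unitSphereLaw_le_abs_sub_mean_le [Nontrivial E] (hF : LipschitzWith K F)
    (hK : 0 < K) {t : ℝ} (ht : 0 ≤ t) :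
    (unitSphereLaw E).real {x | t ≤ |F x - ∫ v, F v ∂(unitSphereLaw E)|} ≤
      4 * Real.exp (-(finrank ℝ E * t ^ 2 / (1152 * K ^ 2))) := by
  have h1 := hF.unitSphereLaw_mean_add_le_le hK ht
  have h2 := hF.neg.unitSphereLaw_mean_add_le_le hK ht
  have hsub : {x | t ≤ |F x - ∫ v, F v ∂(unitSphereLaw E)|} ⊆
      {x | ∫ v, F v ∂(unitSphereLaw E) + t ≤ F x} ∪
        {x | ∫ v, (-F) v ∂(unitSphereLaw E) + t ≤ (-F) x} := by
    intro x hx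
    simp only [Set.mem_union, Set.mem_ofPred_eq, Pi.neg_apply, integral_neg] at hx ⊢
    rcases le_abs.1 hx with h | h
    · left; linarith
    · right; linarith
  refine (measureReal_mono hsub).trans ((measureReal_union_le _ _).trans ?_)
  linarith

/-- Layer-cake integration of the two-sided tail. The constant comes from `1152 π ≤ 4608 ≤ 68²`. -/
theorem LipschitzWith.integral_abs_sub_mean_unitSphereLaw_le [Nontrivial E]
    (hF : LipschitzWith K F) (hK : 0 < K) :
    ∫ x, |F x - ∫ v, F v ∂(unitSphereLaw E)| ∂(unitSphereLaw E) ≤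
      136 * K / √(finrank ℝ E) := by
  set m := ∫ v, F v ∂(unitSphereLaw E) with hm
  set N : ℝ := (finrank ℝ E : ℝ) with hNdef
  have hN : 0 < N := Nat.cast_pos.2 finrank_pos
  have hK' : (0 : ℝ) < K := hK
  have hFm : Measurable F := hF.continuous.measurable
  set b : ℝ := N / (1152 * K ^ 2) with hb
  have hb0 : 0 < b := by positivity
  have hi : Integrable (fun x => |F x - m|) (unitSphereLaw E) :=
    (hF.integrable_unitSphereLaw.sub (integrable_const _)).abs
  have key : ∫⁻ x, ENNReal.ofReal |F x - m| ∂(unitSphereLaw E) ≤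
      ENNReal.ofReal (2 * √(Real.pi / b)) := by
    rw [lintegral_eq_lintegral_meas_le _ (ae_of_all _ fun _ => abs_nonneg _) hi.aemeasurable]
    have hg : IntegrableOn (fun t : ℝ => 4 * Real.exp (-b * t ^ 2)) (Set.Ioi 0) :=
      ((integrable_exp_neg_mul_sq hb0).const_mul 4).integrableOn
    have hI : ∫ t in Set.Ioi (0 : ℝ), 4 * Real.exp (-b * t ^ 2) = 2 * √(Real.pi / b) := by
      rw [integral_const_mul, integral_gaussian_Ioi]; ring
    rw [← hI, ofReal_integral_eq_lintegral_ofReal hg (ae_of_all _ fun _ => by positivity)]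
    refine setLIntegral_mono' measurableSet_Ioi fun t ht => ?_
    rw [← ofReal_measureReal]
    refine ENNReal.ofReal_le_ofReal ((hF.unitSphereLaw_le_abs_sub_mean_le hK
      (le_of_lt ht)).trans_eq ?_)
    rw [hb]
    congr 2
    ring
  rw [← ofReal_integral_eq_lintegral_ofReal hi (ae_of_all _ fun _ => abs_nonneg _),
    ENNReal.ofReal_le_ofReal_iff (by positivity)] at key
  refine key.trans ?_
  have h1 : √(Real.pi / b) ≤ 68 * K / √N := by
    rw [show 68 * K / √N = √((68 * K) ^ 2 / N) by
      rw [Real.sqrt_div' _ hN.le, Real.sqrt_sq (by positivity)]]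
    refine Real.sqrt_le_sqrt ?_
    rw [hb, div_div_eq_mul_div]
    gcongr
    nlinarith [Real.pi_lt_four, sq_nonneg (K : ℝ)]
  calc 2 * √(Real.pi / b) ≤ 2 * (68 * K / √N) := by gcongr
    _ = 136 * K / √N := by ring

end SphereConcentration

namespace SpinChain

/-! ### Stability of spectral measures in Hilbert–Schmidt norm -/

section SpectralStability

variable {ι : Type} [Fintype ι]

theorem re_trace_mul_conjTranspose (M : Matrix ι ι ℂ) :
    (M * M.conjTranspose).trace.re = ∑ i, ∑ j, Complex.normSq (M i j) := by
  simp only [Matrix.trace, Matrix.diag_apply, Matrix.mul_apply, Matrix.conjTranspose_apply,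
    Complex.re_sum]
  refine Finset.sum_congr rfl fun i _ => Finset.sum_congr rfl fun j _ => ?_
  rw [Complex.star_def, Complex.mul_conj, Complex.ofReal_re]

variable [DecidableEq ι] {A B : Matrix ι ι ℂ}

theorem eigenvectorUnitary_mul_star (hA : A.IsHermitian) :
    (hA.eigenvectorUnitary : Matrix ι ι ℂ) * star (hA.eigenvectorUnitary : Matrix ι ι ℂ) = 1 :=
  Matrix.mem_unitaryGroup_iff.1 hA.eigenvectorUnitary.2

theorem star_mul_eigenvectorUnitary (hA : A.IsHermitian) :
    star (hA.eigenvectorUnitary : Matrix ι ι ℂ) * (hA.eigenvectorUnitary : Matrix ι ι ℂ) = 1 :=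
  Matrix.mem_unitaryGroup_iff'.1 hA.eigenvectorUnitary.2

/-- The matrix of inner products between eigenbases of two Hermitian matrices. -/
noncomputable def eigenOverlap (hA : A.IsHermitian) (hB : B.IsHermitian) : Matrix ι ι ℂ :=
  star (hA.eigenvectorUnitary : Matrix ι ι ℂ) * (hB.eigenvectorUnitary : Matrix ι ι ℂ)

theorem eigenOverlap_mul_conjTranspose (hA : A.IsHermitian) (hB : B.IsHermitian) :
    eigenOverlap hA hB * (eigenOverlap hA hB).conjTranspose = 1 := by
  rw [← Matrix.star_eq_conjTranspose, eigenOverlap, star_mul, star_star, mul_assoc,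
    ← mul_assoc (hB.eigenvectorUnitary : Matrix ι ι ℂ), eigenvectorUnitary_mul_star, one_mul,
    star_mul_eigenvectorUnitary]

theorem conjTranspose_eigenOverlap (hA : A.IsHermitian) (hB : B.IsHermitian) :
    (eigenOverlap hA hB).conjTranspose = eigenOverlap hB hA := by
  rw [← Matrix.star_eq_conjTranspose, eigenOverlap, eigenOverlap, star_mul, star_star]

theorem sum_normSq_eigenOverlap (hA : A.IsHermitian) (hB : B.IsHermitian) (i : ι) :
    ∑ j, Complex.normSq (eigenOverlap hA hB i j) = 1 := by
  have h := congrFun (congrFun (eigenOverlap_mul_conjTranspose hA hB) i) i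
  rw [Matrix.mul_apply, Matrix.one_apply_eq] at h
  simp only [Matrix.conjTranspose_apply, Complex.star_def, Complex.mul_conj] at h
  exact_mod_cast h

theorem normSq_eigenOverlap_comm (hA : A.IsHermitian) (hB : B.IsHermitian) (i j : ι) :
    Complex.normSq (eigenOverlap hA hB i j) = Complex.normSq (eigenOverlap hB hA j i) := by
  rw [← conjTranspose_eigenOverlap hA hB, Matrix.conjTranspose_apply, Complex.star_def,
    Complex.normSq_conj]

theorem mul_eigenvectorUnitary (hA : A.IsHermitian) :
    A * (hA.eigenvectorUnitary : Matrix ι ι ℂ) =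
      (hA.eigenvectorUnitary : Matrix ι ι ℂ) *
        Matrix.diagonal (fun i => (hA.eigenvalues i : ℂ)) := by
  have key : A = (hA.eigenvectorUnitary : Matrix ι ι ℂ) *
      Matrix.diagonal (fun i => (hA.eigenvalues i : ℂ)) *
        star (hA.eigenvectorUnitary : Matrix ι ι ℂ) := hA.spectral_theorem
  refine (congrArg (· * (hA.eigenvectorUnitary : Matrix ι ι ℂ)) key).trans ?_
  simp only [mul_assoc, star_mul_eigenvectorUnitary, mul_one]

theorem star_eigenvectorUnitary_mul (hA : A.IsHermitian) :
    star (hA.eigenvectorUnitary : Matrix ι ι ℂ) * A =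
      Matrix.diagonal (fun i => (hA.eigenvalues i : ℂ)) *
        star (hA.eigenvectorUnitary : Matrix ι ι ℂ) := by
  have key : A = (hA.eigenvectorUnitary : Matrix ι ι ℂ) *
      Matrix.diagonal (fun i => (hA.eigenvalues i : ℂ)) *
        star (hA.eigenvectorUnitary : Matrix ι ι ℂ) := hA.spectral_theorem
  refine (congrArg (star (hA.eigenvectorUnitary : Matrix ι ι ℂ) * ·) key).trans ?_
  simp only [← mul_assoc, star_mul_eigenvectorUnitary, one_mul]

/-- The squared Hilbert–Schmidt distance of two Hermitian matrices as a transport cost between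
their spectra. -/
theorem sum_normSq_eigenOverlap_mul_sq_sub (hA : A.IsHermitian) (hB : B.IsHermitian) :
    ∑ i, ∑ j, Complex.normSq (eigenOverlap hA hB i j) *
      (hA.eigenvalues i - hB.eigenvalues j) ^ 2 = ((A - B) * (A - B)).trace.re := by
  set U := (hA.eigenvectorUnitary : Matrix ι ι ℂ) with hU
  set V := (hB.eigenvectorUnitary : Matrix ι ι ℂ) with hV
  -- Between an eigenbasis of `A` and one of `B`, the difference `A - B` has these entries; unitary
  -- factors do not change the Hilbert–Schmidt norm.
  have hM : ∀ i j, (star U * (A - B) * V) i j =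
      ((hA.eigenvalues i - hB.eigenvalues j : ℝ) : ℂ) * eigenOverlap hA hB i j := by
    intro i j
    rw [mul_sub, sub_mul, star_eigenvectorUnitary_mul hA, mul_assoc (star U) B,
      mul_eigenvectorUnitary hB, ← mul_assoc, mul_assoc (Matrix.diagonal _)]
    change (Matrix.diagonal (fun i => (hA.eigenvalues i : ℂ)) * eigenOverlap hA hB -
      eigenOverlap hA hB * Matrix.diagonal (fun i => (hB.eigenvalues i : ℂ)) : Matrix ι ι ℂ) i j = _
    rw [Matrix.sub_apply, Matrix.diagonal_mul, Matrix.mul_diagonal]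
    push_cast
    ring
  have htr : ((star U * (A - B) * V) * (star U * (A - B) * V).conjTranspose).trace =
      ((A - B) * (A - B)).trace := by
    have hAB : star (A - B) = A - B := (hA.sub hB).eq
    rw [← Matrix.star_eq_conjTranspose, star_mul, star_mul, star_star, hAB, mul_assoc,
      ← mul_assoc V, eigenvectorUnitary_mul_star, one_mul, mul_assoc, Matrix.trace_mul_comm,
      mul_assoc, mul_assoc, eigenvectorUnitary_mul_star, mul_one]
  rw [← htr, re_trace_mul_conjTranspose]
  refine Finset.sum_congr rfl fun i _ => Finset.sum_congr rfl fun j _ => ?_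
  rw [hM, Complex.normSq_mul, Complex.normSq_ofReal]
  ring

/-- The squared overlaps form a doubly stochastic matrix, hence a coupling of the two spectra. Its
quadratic cost is known, and Cauchy–Schwarz bounds the linear cost; no ordering of eigenvalues is
needed. -/
theorem abs_sum_eigenvalues_sub_le (hA : A.IsHermitian) (hB : B.IsHermitian) {f : ℝ → ℝ}
    (hf : LipschitzWith 1 f) :
    |∑ i, f (hA.eigenvalues i) - ∑ i, f (hB.eigenvalues i)| ≤
      √(Fintype.card ι * ((A - B) * (A - B)).trace.re) := by
  set p : ι → ι → ℝ := fun i j => Complex.normSq (eigenOverlap hA hB i j) with hp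
  have hp0 : ∀ i j, 0 ≤ p i j := fun i j => Complex.normSq_nonneg _
  have h1 : ∑ i, f (hA.eigenvalues i) = ∑ i, ∑ j, p i j * f (hA.eigenvalues i) := by
    refine Finset.sum_congr rfl fun i _ => ?_
    rw [← Finset.sum_mul, hp, sum_normSq_eigenOverlap, one_mul]
  have h2 : ∑ j, f (hB.eigenvalues j) = ∑ i, ∑ j, p i j * f (hB.eigenvalues j) := by
    rw [Finset.sum_comm]
    refine Finset.sum_congr rfl fun j _ => ?_
    simp only [hp, normSq_eigenOverlap_comm hA hB]
    rw [← Finset.sum_mul, sum_normSq_eigenOverlap, one_mul]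
  have h3 : |∑ i, f (hA.eigenvalues i) - ∑ i, f (hB.eigenvalues i)| ≤
      ∑ q : ι × ι, p q.1 q.2 * |hA.eigenvalues q.1 - hB.eigenvalues q.2| := by
    rw [h1, h2, ← Finset.sum_sub_distrib, Fintype.sum_prod_type]
    refine (Finset.abs_sum_le_sum_abs _ _).trans (Finset.sum_le_sum fun i _ => ?_)
    rw [← Finset.sum_sub_distrib]
    refine (Finset.abs_sum_le_sum_abs _ _).trans (Finset.sum_le_sum fun j _ => ?_)
    rw [← mul_sub, abs_mul, abs_of_nonneg (hp0 i j)]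
    refine mul_le_mul_of_nonneg_left ?_ (hp0 i j)
    simpa [Real.dist_eq] using hf.dist_le_mul (hA.eigenvalues i) (hB.eigenvalues j)
  refine h3.trans (Real.le_sqrt_of_sq_le ?_)
  refine (Finset.sum_sq_le_sum_mul_sum_of_sq_le_mul Finset.univ
    (f := fun q : ι × ι => p q.1 q.2)
    (g := fun q : ι × ι => p q.1 q.2 * (hA.eigenvalues q.1 - hB.eigenvalues q.2) ^ 2)
    (fun q _ => hp0 _ _) (fun q _ => mul_nonneg (hp0 _ _) (sq_nonneg _))
    (fun q _ => by rw [mul_pow, sq_abs, sq (p q.1 q.2), mul_assoc])).trans_eq ?_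
  rw [Fintype.sum_prod_type, Fintype.sum_prod_type, sum_normSq_eigenOverlap_mul_sq_sub hA hB]
  simp [hp, sum_normSq_eigenOverlap]

theorem integral_spectralMeasure (hA : A.IsHermitian) (f : ℝ → ℝ) :
    ∫ y, f y ∂(spectralMeasure hA) = (Fintype.card ι : ℝ)⁻¹ * ∑ i, f (hA.eigenvalues i) := by
  rw [spectralMeasure, integral_smul_measure,
    integral_finsetSum_measure fun i _ => integrable_dirac (by simp)]
  simp

/-- Integrals of 1-Lipschitz functions against spectral measures are stable in the normalized
Hilbert–Schmidt norm. -/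
theorem abs_integral_spectralMeasure_sub_le (hA : A.IsHermitian) (hB : B.IsHermitian) {f : ℝ → ℝ}
    (hf : LipschitzWith 1 f) :
    |∫ y, f y ∂(spectralMeasure hA) - ∫ y, f y ∂(spectralMeasure hB)| ≤
      √(((A - B) * (A - B)).trace.re / Fintype.card ι) := by
  rw [integral_spectralMeasure, integral_spectralMeasure, ← mul_sub, abs_mul,
    abs_of_nonneg (by positivity)]
  rcases (Nat.cast_nonneg (α := ℝ) (Fintype.card ι)).eq_or_lt with h0 | h0
  · rw [← h0]; simp
  refine (mul_le_mul_of_nonneg_left (abs_sum_eigenvalues_sub_le hA hB hf)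
    (by positivity)).trans_eq ?_
  rw [Real.sqrt_mul h0.le, Real.sqrt_div' _ h0.le]
  have := Real.mul_self_sqrt h0.le
  field_simp
  rw [sq, this]

end SpectralStability

/-! ### Orthogonality of Pauli products and the Lipschitz bound -/

section HilbertSchmidt

variable {n : ℕ}

theorem pauli_mul_self (a : Fin 3) : pauli a * pauli a = 1 := by
  fin_cases a <;> ext i j <;> fin_cases i <;> fin_cases j <;> simp [pauli]

theorem trace_pauli (a : Fin 3) : (pauli a).trace = 0 := by
  fin_cases a <;> simp [pauli, Matrix.trace_fin_two]

theorem trace_pauli_mul_pauli {a b : Fin 3} (h : a ≠ b) : (pauli a * pauli b).trace = 0 := by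
  fin_cases a <;> fin_cases b <;> first
    | exact absurd rfl h
    | simp [pauli, Matrix.trace_fin_two]

theorem trace_tensor (M : Fin n → Matrix (Fin 2) (Fin 2) ℂ) :
    (tensor M).trace = ∏ k, (M k).trace := by
  simp only [Matrix.trace, Matrix.diag_apply, tensor, Matrix.of_apply]
  exact (Fintype.prod_sum fun k i => M k i i).symm

theorem tensor_one : tensor (fun _ : Fin n => (1 : Matrix (Fin 2) (Fin 2) ℂ)) = 1 := by
  ext s t
  simp only [tensor, Matrix.of_apply, Matrix.one_apply]
  by_cases h : s = t
  · simp [h]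
  · obtain ⟨k, hk⟩ := Function.ne_iff.1 h
    rw [if_neg h]
    exact Finset.prod_eq_zero (Finset.mem_univ k) (if_neg hk)

theorem site_mul_self (a : Fin 3) (j : Fin n) : site n a j * site n a j = 1 := by
  rw [site, tensor_mul, ← tensor_one]
  congr 1
  funext k
  by_cases h : k = j
  · subst h; simp [pauli_mul_self]
  · simp [Function.update_of_ne h]

theorem site_mem_unitaryGroup (a : Fin 3) (j : Fin n) :
    site n a j ∈ Matrix.unitaryGroup (Fin n → Fin 2) ℂ := by
  rw [Matrix.mem_unitaryGroup_iff, Matrix.star_eq_conjTranspose, (site_isHermitian n a j).eq,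
    site_mul_self]

/-- The two-site Pauli product `σ⁽ᵃ⁾_j σ⁽ᵇ⁾_{j+1}`. -/
noncomputable def bond (p : Fin 3 × Fin 3 × Fin n) : Matrix (Fin n → Fin 2) (Fin n → Fin 2) ℂ :=
  site n p.1 p.2.2 * site n p.2.1 (finRotate n p.2.2)

theorem hamiltonian_eq_sum_bond (x : Coeff n) :
    hamiltonian n x = ∑ p, (x p : ℂ) • bond p := by
  rw [hamiltonian, Fintype.sum_prod_type, Finset.sum_comm]
  refine Finset.sum_congr rfl fun a _ => ?_
  rw [Fintype.sum_prod_type, Finset.sum_comm]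
  rfl

theorem hamiltonian_sub (x y : Coeff n) :
    hamiltonian n x - hamiltonian n y = hamiltonian n (x - y) := by
  simp only [hamiltonian_eq_sum_bond, ← Finset.sum_sub_distrib, ← sub_smul]
  simp

theorem norm_trace_bond_mul_bond_le (p q : Fin 3 × Fin 3 × Fin n) :
    ‖(bond p * bond q).trace‖ ≤ 2 ^ n := by
  have hU : bond p * bond q ∈ Matrix.unitaryGroup (Fin n → Fin 2) ℂ :=
    mul_mem (mul_mem (site_mem_unitaryGroup _ _) (site_mem_unitaryGroup _ _))
      (mul_mem (site_mem_unitaryGroup _ _) (site_mem_unitaryGroup _ _))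
  rw [Matrix.trace]
  refine (norm_sum_le _ _).trans ((Finset.sum_le_card_nsmul _ _ 1 fun s _ =>
    entry_norm_bound_of_unitary hU s s).trans ?_)
  simp

/-- The relabelling `(a, b, j) ↦ (b, a, j + 1)`. Two different bond operators can only fail to be
orthogonal if they are related in this way, which happens for `n = 2`. -/
def bondSwap (n : ℕ) : Fin 3 × Fin 3 × Fin n ≃ Fin 3 × Fin 3 × Fin n where
  toFun p := (p.2.1, p.1, finRotate n p.2.2)
  invFun p := (p.2.1, p.1, (finRotate n).symm p.2.2)
  left_inv p := by simp only [Equiv.symm_apply_apply]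
  right_inv p := by simp only [Equiv.apply_symm_apply]

/-- The trace factors over sites, so one site suffices that carries either a single Pauli matrix or
two different ones. -/
theorem trace_bond_mul_bond_eq_zero (hn : 2 ≤ n) {p q : Fin 3 × Fin 3 × Fin n} (h1 : q ≠ p)
    (h2 : q ≠ bondSwap n p) : (bond p * bond q).trace = 0 := by
  obtain ⟨a, b, j⟩ := p
  obtain ⟨a', b', j'⟩ := q
  have hj := finRotate_ne hn j
  have hj' := finRotate_ne hn j'
  have hinj : finRotate n j = finRotate n j' ↔ j = j' := (finRotate n).injective.eq_iff
  simp only [bondSwap, Equiv.coe_fn_mk, ne_eq, Prod.mk.injEq, not_and] at h1 h2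
  simp only [bond, site, tensor_mul, trace_tensor]
  generalize finRotate n j = l at *
  generalize finRotate n j' = l' at *
  let I : Fin n → Matrix (Fin 2) (Fin 2) ℂ := fun _ => 1
  suffices h : ∃ k, (Function.update I j (pauli a) k * Function.update I l (pauli b) k *
      (Function.update I j' (pauli a') k * Function.update I l' (pauli b') k)).trace = 0 by
    obtain ⟨k, hk⟩ := h
    exact Finset.prod_eq_zero (Finset.mem_univ k) hk
  by_cases e1 : j = j'
  · subst e1
    have e2 : l = l' := hinj.2 rfl
    subst e2
    by_cases ha : a = a'
    · refine ⟨l, ?_⟩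
      have hb : b ≠ b' := fun hb => h1 ha.symm hb.symm rfl
      simp [I, Function.update_of_ne hj.symm, trace_pauli_mul_pauli hb]
    · refine ⟨j, ?_⟩
      simp [I, Function.update_of_ne hj, trace_pauli_mul_pauli ha]
  · have e2 : l ≠ l' := fun h => e1 (hinj.1 h)
    by_cases e3 : j = l'
    · subst e3
      by_cases ha : a = b'
      · by_cases e4 : l = j'
        · subst e4
          have hb : b ≠ a' := fun hb => h2 hb.symm ha.symm rfl
          refine ⟨l, ?_⟩
          simp [I, Function.update_of_ne hj.symm, trace_pauli_mul_pauli hb]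
        · refine ⟨l, ?_⟩
          simp [I, Function.update_of_ne hj.symm, Function.update_of_ne e4, trace_pauli]
      · refine ⟨j, ?_⟩
        simp [I, Function.update_of_ne hj, Function.update_of_ne e1, trace_pauli_mul_pauli ha]
    · refine ⟨j, ?_⟩
      simp [I, Function.update_of_ne hj, Function.update_of_ne e1, Function.update_of_ne e3,
        trace_pauli]

/-- In the double sum over bonds only `q = p` and `q = bondSwap n p` survive. Each family
contributes at most `2 ^ n * ‖x‖ ^ 2`, the second because `bondSwap n` is a permutation and `2|uv| ≤
u² + v²`. -/
theorem re_trace_hamiltonian_sq_le (hn : 2 ≤ n) (x : Coeff n) :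
    (hamiltonian n x * hamiltonian n x).trace.re ≤ 2 ^ n * (2 * ‖x‖ ^ 2) := by
  have h1 : (hamiltonian n x * hamiltonian n x).trace.re =
      ∑ p, ∑ q, x p * x q * (bond p * bond q).trace.re := by
    simp only [hamiltonian_eq_sum_bond, Finset.sum_mul_sum, Matrix.trace_sum, Complex.re_sum,
      smul_mul_smul_comm, Matrix.trace_smul, smul_eq_mul, ← Complex.ofReal_mul,
      Complex.re_ofReal_mul]
  have h2 : ∀ p q, x p * x q * (bond p * bond q).trace.re ≤
      (if q = p then 2 ^ n * (|x p| * |x q|) else 0) +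
        (if q = bondSwap n p then 2 ^ n * (|x p| * |x q|) else 0) := by
    intro p q
    have hb : x p * x q * (bond p * bond q).trace.re ≤ 2 ^ n * (|x p| * |x q|) := by
      refine (le_abs_self _).trans ?_
      rw [abs_mul, abs_mul, mul_comm]
      gcongr
      exact (Complex.abs_re_le_norm _).trans (norm_trace_bond_mul_bond_le p q)
    have h0 : 0 ≤ 2 ^ n * (|x p| * |x q|) := by positivity
    by_cases e1 : q = p
    · rw [if_pos e1]
      split_ifs <;> linarith
    · by_cases e2 : q = bondSwap n p
      · rw [if_neg e1, if_pos e2]; linarith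
      · rw [if_neg e1, if_neg e2, trace_bond_mul_bond_eq_zero hn e1 e2]; simp
  rw [h1]
  refine (Finset.sum_le_sum fun p _ => Finset.sum_le_sum fun q _ => h2 p q).trans ?_
  simp only [Finset.sum_add_distrib, Finset.sum_ite_eq', Finset.mem_univ, if_true]
  rw [← Finset.mul_sum, ← Finset.mul_sum, ← mul_add, EuclideanSpace.real_norm_sq_eq, two_mul]
  refine mul_le_mul_of_nonneg_left (add_le_add (Finset.sum_le_sum fun p _ => ?_) ?_)
    (by positivity)
  · rw [← sq, sq_abs]
  · have h3 : ∑ p, x (bondSwap n p) ^ 2 = ∑ p, x p ^ 2 :=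
      Equiv.sum_comp (bondSwap n) fun p => x p ^ 2
    have h4 : ∑ p, |x p| * |x (bondSwap n p)| ≤ ∑ p, (x p ^ 2 + x (bondSwap n p) ^ 2) / 2 :=
      Finset.sum_le_sum fun p _ => by
        nlinarith [sq_nonneg (|x p| - |x (bondSwap n p)|), sq_abs (x p),
          sq_abs (x (bondSwap n p))]
    refine h4.trans_eq ?_
    rw [← Finset.sum_div, Finset.sum_add_distrib, h3]
    ring

theorem abs_integral_empirical_sub_le (hn : 2 ≤ n) {f : ℝ → ℝ} (hf : LipschitzWith 1 f)
    (x y : Coeff n) :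
    |∫ z, f z ∂(empirical hn x) - ∫ z, f z ∂(empirical hn y)| ≤ 2 * ‖x - y‖ := by
  refine (abs_integral_spectralMeasure_sub_le _ _ hf).trans ?_
  rw [hamiltonian_sub]
  refine Real.sqrt_le_iff.2 ⟨by positivity, ?_⟩
  have hc : (Fintype.card (Fin n → Fin 2) : ℝ) = 2 ^ n := by simp
  rw [hc, div_le_iff₀ (by positivity)]
  refine (re_trace_hamiltonian_sq_le hn _).trans ?_
  have : (0 : ℝ) < 2 ^ n := by positivity
  nlinarith [mul_nonneg this.le (sq_nonneg ‖x - y‖)]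

theorem lipschitzWith_integral_empirical (hn : 2 ≤ n) {f : ℝ → ℝ} (hf : LipschitzWith 1 f) :
    LipschitzWith 2 fun x => ∫ z, f z ∂(empirical hn x) :=
  LipschitzWith.of_dist_le_mul fun x y => by
    rw [Real.dist_eq, dist_eq_norm]
    exact abs_integral_empirical_sub_le hn hf x y

/-- The second moment is the normalized trace of `H²`. -/
theorem lintegral_sq_empirical_le (hn : 2 ≤ n) (x : Coeff n) :
    ∫⁻ y, ENNReal.ofReal (y ^ 2) ∂(empirical hn x) ≤ ENNReal.ofReal (2 * ‖x‖ ^ 2) := by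
  have hi : Integrable (fun y : ℝ => y ^ 2) (empirical hn x) := by
    rw [empirical, spectralMeasure]
    refine Integrable.smul_measure ?_ (by simp)
    exact integrable_finsetSum_measure.2 fun i _ => integrable_dirac (by simp)
  rw [← ofReal_integral_eq_lintegral_ofReal hi (ae_of_all _ fun y => sq_nonneg y)]
  refine ENNReal.ofReal_le_ofReal ?_
  rw [empirical, integral_spectralMeasure]
  have h := sum_eval_eigenvalues (hamiltonian_isHermitian hn x) (Polynomial.X ^ 2)
  simp only [Polynomial.eval_pow, Polynomial.eval_X, Polynomial.map_pow, Polynomial.map_X,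
    map_pow, Polynomial.aeval_X] at h
  rw [h, sq]
  have hc : (Fintype.card (Fin n → Fin 2) : ℝ) = 2 ^ n := by simp
  rw [hc, inv_mul_le_iff₀ (by positivity)]
  exact re_trace_hamiltonian_sq_le hn x

end HilbertSchmidt

end SpinChain

namespace SpinChain

/-! ### Bounded-Lipschitz distance through finitely many ramps -/

section BoundedLipschitz

theorem abs_le_one_of_blNorm_le_one {f : ℝ → ℝ} (hf : blNorm f ≤ 1) (x : ℝ) : |f x| ≤ 1 := by
  have h : ‖f x‖ₑ ≤ 1 := (le_iSup (fun x => ‖f x‖ₑ) x).trans (le_self_add.trans hf)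
  rw [← Real.norm_eq_abs, ← enorm_norm, Real.enorm_of_nonneg (norm_nonneg _)] at *
  simpa using h

/-- The infimum of Lipschitz constants is not known to be attained in advance, so constants below `1
+ δ` are used and `δ` is made small. -/
theorem lipschitzWith_one_of_blNorm_le_one {f : ℝ → ℝ} (hf : blNorm f ≤ 1) :
    LipschitzWith 1 f := by
  have h : ⨅ (K : ℝ≥0) (_ : LipschitzWith K f), (K : ℝ≥0∞) ≤ 1 := le_add_self.trans hf
  refine LipschitzWith.of_dist_le_mul fun x y => ?_
  rw [NNReal.coe_one, one_mul]
  refine le_of_forall_pos_le_add fun ε hε => ?_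
  set δ : ℝ≥0 := (ε / (dist x y + 1)).toNNReal with hδ
  have hd : 0 < dist x y + 1 := by positivity
  have hδ0 : 0 < δ := Real.toNNReal_pos.2 (by positivity)
  have hlt : ⨅ (K : ℝ≥0) (_ : LipschitzWith K f), (K : ℝ≥0∞) < (1 + δ : ℝ≥0) := by
    refine h.trans_lt ?_
    exact_mod_cast lt_add_of_pos_right (1 : ℝ≥0) hδ0
  simp only [iInf_lt_iff] at hlt
  obtain ⟨K, hK, hK1⟩ := hlt
  have hK2 : (K : ℝ) ≤ 1 + δ := by exact_mod_cast hK1.le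
  have hK3 : (δ : ℝ) * (dist x y + 1) = ε := by
    rw [hδ, Real.coe_toNNReal _ (by positivity), div_mul_cancel₀ _ hd.ne']
  have := hK.dist_le_mul x y
  nlinarith [dist_nonneg (x := x) (y := y), δ.2]

theorem blNorm_zero : blNorm (fun _ => 0) = 0 := by
  have h : ⨅ (K : ℝ≥0) (_ : LipschitzWith K fun _ : ℝ => (0 : ℝ)), (K : ℝ≥0∞) ≤ 0 :=
    (iInf₂_le (0 : ℝ≥0) (LipschitzWith.const 0)).trans (by simp)
  rw [blNorm, le_zero_iff.1 h]
  simp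

variable {μ ν : Measure ℝ}

theorem dBL_le {c : ℝ}
    (h : ∀ f : ℝ → ℝ, blNorm f ≤ 1 → |∫ x, f x ∂μ - ∫ x, f x ∂ν| ≤ c) : dBL μ ν ≤ c := by
  refine csSup_le ⟨_, fun _ => 0, by simp [blNorm_zero], rfl⟩ ?_
  rintro _ ⟨f, hf, rfl⟩
  exact h f hf

theorem abs_integral_sub_le_two [IsProbabilityMeasure μ] [IsProbabilityMeasure ν] {f : ℝ → ℝ}
    (hf : blNorm f ≤ 1) : |∫ x, f x ∂μ - ∫ x, f x ∂ν| ≤ 2 := by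
  have h : ∀ ρ : Measure ℝ, IsProbabilityMeasure ρ → |∫ x, f x ∂ρ| ≤ 1 := fun ρ _ => by
    simpa using norm_integral_le_of_norm_le_const (μ := ρ) (f := f)
      (ae_of_all _ (abs_le_one_of_blNorm_le_one hf))
  refine (abs_sub _ _).trans ?_
  linarith [h μ inferInstance, h ν inferInstance]

/-- The bound 2 matters: the real supremum of an unbounded set would be `0`. -/
theorem le_dBL [IsProbabilityMeasure μ] [IsProbabilityMeasure ν] {f : ℝ → ℝ}
    (hf : blNorm f ≤ 1) : |∫ x, f x ∂μ - ∫ x, f x ∂ν| ≤ dBL μ ν :=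
  le_csSup ⟨2, by rintro _ ⟨f, hf, rfl⟩; exact abs_integral_sub_le_two hf⟩ ⟨f, hf, rfl⟩

/-- The function that is `0` left of `c`, `δ` right of `c + δ`, and of slope `1` in between. -/
def ramp (δ c x : ℝ) : ℝ := max 0 (min (x - c) δ)

theorem lipschitzWith_ramp (δ c : ℝ) : LipschitzWith 1 (ramp δ c) := by
  have h : LipschitzWith 1 fun x : ℝ => x - c :=
    LipschitzWith.of_dist_le_mul fun x y => by simp [Real.dist_eq]
  exact (h.min_const δ).const_max 0

theorem ramp_of_le {δ c x : ℝ} (h : x ≤ c) : ramp δ c x = 0 :=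
  max_eq_left ((min_le_left _ _).trans (by linarith))

theorem ramp_of_ge {δ c x : ℝ} (hδ : 0 ≤ δ) (h : c + δ ≤ x) : ramp δ c x = δ := by
  rw [ramp, min_eq_right (by linarith), max_eq_right hδ]

theorem abs_ramp_le {δ : ℝ} (hδ : 0 ≤ δ) (c x : ℝ) : |ramp δ c x| ≤ δ := by
  rw [abs_of_nonneg (le_max_left _ _)]
  exact max_le hδ (min_le_right _ _)

/-- The slope of `f` on the `i`-th interval of the grid `t + i δ`. -/
noncomputable def gridSlope (f : ℝ → ℝ) (t δ : ℝ) (i : ℕ) : ℝ :=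
  (f (t + (i + 1 : ℕ) * δ) - f (t + i * δ)) / δ

/-- Piecewise linear interpolation of `f` on the first `k` intervals of the grid `t + i δ`. -/
noncomputable def interpolant (f : ℝ → ℝ) (t δ : ℝ) (k : ℕ) (x : ℝ) : ℝ :=
  f t + ∑ i ∈ Finset.range k, gridSlope f t δ i * ramp δ (t + i * δ) x

variable {f : ℝ → ℝ} {t δ : ℝ}

theorem abs_gridSlope_le_one (hf : LipschitzWith 1 f) (hδ : 0 < δ) (i : ℕ) :
    |gridSlope f t δ i| ≤ 1 := by
  rw [gridSlope, abs_div, abs_of_pos hδ, div_le_one hδ]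
  have := hf.dist_le_mul (t + (i + 1 : ℕ) * δ) (t + i * δ)
  rw [Real.dist_eq, Real.dist_eq, NNReal.coe_one, one_mul] at this
  refine this.trans_eq ?_
  rw [show t + (i + 1 : ℕ) * δ - (t + i * δ) = δ by push_cast; ring, abs_of_pos hδ]

theorem interpolant_of_le (hδ : 0 < δ) (k : ℕ) {x : ℝ} (hx : x ≤ t) :
    interpolant f t δ k x = f t := by
  rw [interpolant, Finset.sum_eq_zero, add_zero]
  intro i _
  have : 0 ≤ (i : ℝ) * δ := by positivity
  rw [ramp_of_le (by linarith), mul_zero]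

/-- All ramps have saturated at `δ`, so the increments telescope. -/
theorem interpolant_of_ge (hδ : 0 < δ) (k : ℕ) {x : ℝ} (hx : t + k * δ ≤ x) :
    interpolant f t δ k x = f (t + k * δ) := by
  rw [interpolant]
  have h : ∀ i ∈ Finset.range k, gridSlope f t δ i * ramp δ (t + i * δ) x =
      f (t + (i + 1 : ℕ) * δ) - f (t + i * δ) := by
    intro i hi
    have h1 : ((i + 1 : ℕ) : ℝ) ≤ k := by exact_mod_cast Finset.mem_range.1 hi
    have h2 := mul_le_mul_of_nonneg_right h1 hδ.le
    push_cast at h2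
    rw [ramp_of_ge hδ.le (by linarith), gridSlope, div_mul_cancel₀ _ hδ.ne']
  rw [Finset.sum_congr rfl h, Finset.sum_range_sub fun i : ℕ => f (t + i * δ)]
  simp

theorem abs_sub_interpolant_le (hf : LipschitzWith 1 f) (hδ : 0 < δ) (k : ℕ) {x : ℝ} (h1 : t ≤ x)
    (h2 : x ≤ t + k * δ) : |f x - interpolant f t δ k x| ≤ 2 * δ := by
  induction k with
  | zero =>
    have : x = t := le_antisymm (by simpa using h2) h1
    rw [interpolant_of_le hδ _ this.le, this, sub_self, abs_zero]
    positivity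
  | succ k ih =>
    have e : interpolant f t δ (k + 1) x =
        interpolant f t δ k x + gridSlope f t δ k * ramp δ (t + k * δ) x := by
      rw [interpolant, interpolant, Finset.sum_range_succ, add_assoc]
    rcases le_total x (t + k * δ) with h | h
    · rw [e, ramp_of_le h, mul_zero, add_zero]
      exact ih h
    · rw [e, interpolant_of_ge hδ k h, ← sub_sub]
      refine (abs_sub _ _).trans ?_
      have h3 := hf.dist_le_mul x (t + k * δ)
      rw [Real.dist_eq, Real.dist_eq, NNReal.coe_one, one_mul, abs_of_nonneg (sub_nonneg.2 h)] at h3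
      have h4 : |gridSlope f t δ k * ramp δ (t + k * δ) x| ≤ 1 * δ := by
        rw [abs_mul]
        exact mul_le_mul (abs_gridSlope_le_one hf hδ k) (abs_ramp_le hδ.le _ _) (abs_nonneg _)
          zero_le_one
      push_cast at h2
      linarith

/-- Outside `[-R, R]` the interpolant is constant, equal to an endpoint value of `f`; the error is
then at most `2 ≤ 2x²/R²`, Chebyshev's bound in pointwise form. -/
theorem abs_sub_interpolant_le_add (hf : LipschitzWith 1 f) (hb : ∀ x, |f x| ≤ 1) {R : ℝ}
    (hR : 0 < R) (hδ : 0 < δ) {k : ℕ} (hk : k * δ = 2 * R) (x : ℝ) :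
    |f x - interpolant f (-R) δ k x| ≤ 2 * δ + 2 / R ^ 2 * x ^ 2 := by
  have hsq : ∀ x, R ≤ |x| → 2 ≤ 2 / R ^ 2 * x ^ 2 := fun x hx => by
    rw [div_mul_eq_mul_div, le_div_iff₀ (by positivity), ← sq_abs x]
    nlinarith
  have hfar : ∀ u, R ≤ |x| → |f x - f u| ≤ 2 * δ + 2 / R ^ 2 * x ^ 2 := fun u hx => by
    refine (abs_sub _ _).trans ?_
    linarith [hsq x hx, hb x, hb u]
  rcases le_total x (-R) with h | h
  · rw [interpolant_of_le hδ _ h]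
    exact hfar _ (by rw [abs_of_nonpos (by linarith)]; linarith)
  · rcases le_total x R with h' | h'
    · refine (abs_sub_interpolant_le hf hδ k h (by rw [hk]; linarith)).trans ?_
      have : 0 ≤ 2 / R ^ 2 * x ^ 2 := by positivity
      linarith
    · rw [interpolant_of_ge hδ _ (by rw [hk]; linarith)]
      exact hfar _ (by rw [abs_of_nonneg (by linarith)]; linarith)

theorem integrable_of_lipschitz_of_bounded [IsProbabilityMeasure μ] {K : ℝ≥0}
    (hf : LipschitzWith K f) {M : ℝ} (hb : ∀ x, |f x| ≤ M) : Integrable f μ :=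
  (integrable_const M).mono' hf.continuous.aestronglyMeasurable (ae_of_all _ hb)

theorem integrable_ramp [IsProbabilityMeasure μ] (hδ : 0 ≤ δ) (c : ℝ) :
    Integrable (ramp δ c) μ :=
  integrable_of_lipschitz_of_bounded (lipschitzWith_ramp δ c) (abs_ramp_le hδ c)

theorem integrable_interpolant [IsProbabilityMeasure μ] (hδ : 0 ≤ δ) (k : ℕ) :
    Integrable (interpolant f t δ k) μ :=
  (integrable_const _).add (integrable_finsetSum _ fun _ _ => (integrable_ramp hδ _).const_mul _)

theorem integral_interpolant [IsProbabilityMeasure μ] (hδ : 0 ≤ δ) (k : ℕ) :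
    ∫ x, interpolant f t δ k x ∂μ =
      f t + ∑ i ∈ Finset.range k, gridSlope f t δ i * ∫ x, ramp δ (t + i * δ) x ∂μ := by
  have hi : ∀ i ∈ Finset.range k,
      Integrable (fun x => gridSlope f t δ i * ramp δ (t + i * δ) x) μ :=
    fun i _ => (integrable_ramp hδ _).const_mul _
  simp only [interpolant]
  rw [integral_add (integrable_const _) (integrable_finsetSum _ hi), integral_finsetSum _ hi]
  simp [integral_const_mul]

theorem abs_integral_sub_interpolant_le [IsProbabilityMeasure μ] {m : ℝ} (hm : 0 ≤ m)
    (hμ : ∫⁻ y, ENNReal.ofReal (y ^ 2) ∂μ ≤ ENNReal.ofReal m) (hf : LipschitzWith 1 f)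
    (hb : ∀ x, |f x| ≤ 1) {R : ℝ} (hR : 0 < R) (hδ : 0 < δ) {k : ℕ} (hk : k * δ = 2 * R) :
    |∫ x, f x ∂μ - ∫ x, interpolant f (-R) δ k x ∂μ| ≤ 2 * δ + 2 / R ^ 2 * m := by
  have hi : Integrable (fun y : ℝ => y ^ 2) μ := by
    refine ⟨by fun_prop, ?_⟩
    rw [hasFiniteIntegral_iff_ofReal (ae_of_all _ fun y => sq_nonneg y)]
    exact hμ.trans_lt ENNReal.ofReal_lt_top
  have hi2 : ∫ y, y ^ 2 ∂μ ≤ m := by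
    rw [← ENNReal.ofReal_le_ofReal_iff hm,
      ofReal_integral_eq_lintegral_ofReal hi (ae_of_all _ fun y => sq_nonneg y)]
    exact hμ
  have hg : Integrable (fun y : ℝ => 2 * δ + 2 / R ^ 2 * y ^ 2) μ :=
    (integrable_const _).add (hi.const_mul _)
  rw [← integral_sub (integrable_of_lipschitz_of_bounded hf hb) (integrable_interpolant hδ.le k)]
  refine (norm_integral_le_of_norm_le
    (f := fun x => f x - interpolant f (-R) δ k x) hg (ae_of_all _ (abs_sub_interpolant_le_add hf hb hR hδ hk))).trans ?_
  rw [integral_add (integrable_const _) (hi.const_mul _), integral_const_mul (2 / R ^ 2)]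
  simp only [integral_const, probReal_univ, one_smul]
  gcongr

/-- The bounded-Lipschitz distance is controlled by finitely many test functions, for measures with
bounded second moments. -/
theorem dBL_le_sum_ramp [IsProbabilityMeasure μ] [IsProbabilityMeasure ν] {m : ℝ} (hm : 0 ≤ m)
    (hμ : ∫⁻ y, ENNReal.ofReal (y ^ 2) ∂μ ≤ ENNReal.ofReal m)
    (hν : ∫⁻ y, ENNReal.ofReal (y ^ 2) ∂ν ≤ ENNReal.ofReal m)
    {R : ℝ} (hR : 0 < R) (hδ : 0 < δ) {k : ℕ} (hk : k * δ = 2 * R) :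
    dBL μ ν ≤ ∑ i ∈ Finset.range k,
      |∫ x, ramp δ (-R + i * δ) x ∂μ - ∫ x, ramp δ (-R + i * δ) x ∂ν| +
        (4 * δ + 4 / R ^ 2 * m) := by
  refine dBL_le fun f hf => ?_
  have hb := abs_le_one_of_blNorm_le_one hf
  have hl := lipschitzWith_one_of_blNorm_le_one hf
  have h1 := abs_integral_sub_interpolant_le hm hμ hl hb hR hδ hk
  have h2 := abs_integral_sub_interpolant_le hm hν hl hb hR hδ hk
  have h3 : |∫ x, interpolant f (-R) δ k x ∂μ - ∫ x, interpolant f (-R) δ k x ∂ν| ≤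
      ∑ i ∈ Finset.range k,
        |∫ x, ramp δ (-R + i * δ) x ∂μ - ∫ x, ramp δ (-R + i * δ) x ∂ν| := by
    -- Both measures have mass 1, so the constant term `f (-R)` cancels.
    rw [integral_interpolant hδ.le, integral_interpolant hδ.le, add_sub_add_left_eq_sub,
      ← Finset.sum_sub_distrib]
    refine (Finset.abs_sum_le_sum_abs _ _).trans (Finset.sum_le_sum fun i _ => ?_)
    rw [← mul_sub, abs_mul]
    exact mul_le_of_le_one_left (abs_nonneg _) (abs_gridSlope_le_one hl hδ i)
  have e : 4 / R ^ 2 * m = 2 * (2 / R ^ 2 * m) := by ring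
  rw [abs_le] at *
  constructor <;> linarith [h1.1, h1.2, h2.1, h2.2, h3.1, h3.2]

end BoundedLipschitz

/-! ### Mean, tail and almost sure bounds for the distance -/

section Concentration

variable {n : ℕ}

instance isProbabilityMeasure_empirical (hn : 2 ≤ n) (x : Coeff n) :
    IsProbabilityMeasure (empirical hn x) :=
  spectralMeasure_prob _

theorem integral_dos (hn : 2 ≤ n) {f : ℝ → ℝ} {K : ℝ≥0} (hf : LipschitzWith K f) {M : ℝ}
    (hb : ∀ x, |f x| ≤ M) :
    ∫ y, f y ∂(dos hn) = ∫ x, ∫ y, f y ∂(empirical hn x) ∂(sphereLaw n) := by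
  have := dos_prob hn
  have := sphereLaw_prob hn
  let κ : Kernel (Coeff n) ℝ := ⟨empirical hn, measurable_empirical hn⟩
  have e : dos hn = (κ ∘ₖ Kernel.const Unit (sphereLaw n)) () :=
    Measure.comp_eq_comp_const_apply (μ := sphereLaw n) (κ := κ)
  have hi : Integrable f (dos hn) := integrable_of_lipschitz_of_bounded hf hb
  rw [e] at hi ⊢
  exact Kernel.integral_comp hi

theorem finrank_coeff (n : ℕ) : Module.finrank ℝ (Coeff n) = 9 * n := by
  rw [finrank_euclideanSpace]
  simp
  ring

theorem nontrivial_coeff (hn : 2 ≤ n) : Nontrivial (Coeff n) := by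
  have : NeZero n := ⟨by omega⟩
  infer_instance

/-- A supremum of 2-Lipschitz functions of `x`, one for each test function. -/
theorem lipschitzWith_dBL (hn : 2 ≤ n) :
    LipschitzWith 2 fun x => dBL (empirical hn x) (dos hn) := by
  have := dos_prob hn
  refine LipschitzWith.of_le_add_mul _ fun x y => dBL_le fun f hf => ?_
  have h1 := abs_integral_empirical_sub_le hn (lipschitzWith_one_of_blNorm_le_one hf) x y
  have h2 := le_dBL (μ := empirical hn y) (ν := dos hn) hf
  rw [dist_eq_norm]
  refine (abs_sub_le _ (∫ z, f z ∂(empirical hn y)) _).trans ?_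
  push_cast
  linarith

theorem ae_lintegral_sq_empirical_le (hn : 2 ≤ n) :
    ∀ᵐ x ∂(sphereLaw n), ∫⁻ y, ENNReal.ofReal (y ^ 2) ∂(empirical hn x) ≤ ENNReal.ofReal 2 := by
  -- `sphereLaw n` is `unitSphereLaw (Coeff n)` by definition.
  filter_upwards [ae_unitSphereLaw_norm_eq_one (E := Coeff n)] with x hx
  refine (lintegral_sq_empirical_le hn x).trans_eq ?_
  rw [hx]
  norm_num

theorem lintegral_sq_dos_le (hn : 2 ≤ n) :
    ∫⁻ y, ENNReal.ofReal (y ^ 2) ∂(dos hn) ≤ ENNReal.ofReal 2 := by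
  have := sphereLaw_prob hn
  rw [dos, Measure.lintegral_bind (measurable_empirical hn).aemeasurable (by fun_prop)]
  exact (lintegral_mono_ae (ae_lintegral_sq_empirical_le hn)).trans (by simp)

/-- The constant is `136 · 2 / √9 ≤ 91`, in dimension `9n`. -/
theorem integral_abs_integral_ramp_sub_le (hn : 2 ≤ n) {δ : ℝ} (hδ : 0 ≤ δ) (c : ℝ) :
    ∫ x, |∫ y, ramp δ c y ∂(empirical hn x) - ∫ y, ramp δ c y ∂(dos hn)| ∂(sphereLaw n) ≤
      91 / √n := by
  have := nontrivial_coeff hn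
  have h := (lipschitzWith_integral_empirical hn
    (lipschitzWith_ramp δ c)).integral_abs_sub_mean_unitSphereLaw_le two_pos
  rw [integral_dos hn (lipschitzWith_ramp δ c) (abs_ramp_le hδ c)]
  refine h.trans ?_
  have hn0 : (0 : ℝ) < n := Nat.cast_pos.2 (by omega)
  have h9 : √(9 : ℝ) = 3 := by
    rw [show (9 : ℝ) = 3 ^ 2 by norm_num, Real.sqrt_sq (by norm_num)]
  rw [finrank_coeff]
  push_cast
  rw [Real.sqrt_mul (by norm_num), h9, ← div_div]
  gcongr
  norm_num

theorem integral_dBL_le (hn : 2 ≤ n) :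
    ∫ x, dBL (empirical hn x) (dos hn) ∂(sphereLaw n) ≤ 198 / (n : ℝ) ^ (1 / 6 : ℝ) := by
  have := nontrivial_coeff hn
  have := sphereLaw_prob hn
  have := dos_prob hn
  have hn1 : (1 : ℝ) ≤ n := by exact_mod_cast (by omega : 1 ≤ n)
  -- The cutoff is `R = u` and the grid has about `u³` intervals, so the mesh `δ` and the tail
  -- `1/R²` are both of order `u⁻² = n^{-1/6}`. The fluctuations of the ramps add up to order `u³/u⁶
  -- = u⁻³`, which is smaller.
  set u : ℝ := (n : ℝ) ^ (1 / 12 : ℝ) with hu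
  have hu1 : 1 ≤ u := Real.one_le_rpow hn1 (by norm_num)
  have hu0 : 0 < u := by linarith
  have hu12 : u ^ 12 = n := by
    rw [hu, ← Real.rpow_natCast, ← Real.rpow_mul (by positivity)]; norm_num
  have hu6 : √(n : ℝ) = u ^ 6 := by
    rw [← hu12, show u ^ 12 = (u ^ 6) ^ 2 by ring, Real.sqrt_sq (by positivity)]
  have hu2 : (n : ℝ) ^ (1 / 6 : ℝ) = u ^ 2 := by
    rw [hu, ← Real.rpow_natCast, ← Real.rpow_mul (by positivity)]; norm_num
  set k : ℕ := ⌈u ^ 3⌉₊ with hk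
  have hk1 : u ^ 3 ≤ k := Nat.le_ceil _
  have hu3 : 1 ≤ u ^ 3 := one_le_pow₀ hu1
  have hk2 : (k : ℝ) ≤ 2 * u ^ 3 := by
    have := Nat.ceil_lt_add_one (show 0 ≤ u ^ 3 by positivity)
    linarith
  have hk0 : (0 : ℝ) < k := by linarith
  set δ : ℝ := 2 * u / k with hδ
  have hδ0 : 0 < δ := by positivity
  have hkδ : k * δ = 2 * u := by rw [hδ]; field_simp
  have hδ1 : δ ≤ 2 / u ^ 2 := by
    rw [hδ, div_le_div_iff₀ hk0 (by positivity)]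
    nlinarith
  set Y : ℕ → Coeff n → ℝ := fun i x => |∫ y, ramp δ (-u + i * δ) y ∂(empirical hn x) -
    ∫ y, ramp δ (-u + i * δ) y ∂(dos hn)| with hY
  have hYi : ∀ i ∈ Finset.range k, Integrable (Y i) (sphereLaw n) := fun i _ =>
    ((lipschitzWith_integral_empirical hn (lipschitzWith_ramp _ _)).integrable_unitSphereLaw.sub
      (integrable_const _)).abs
  have hS : Integrable (fun x => ∑ i ∈ Finset.range k, Y i x) (sphereLaw n) :=
    integrable_finsetSum _ hYi
  calc ∫ x, dBL (empirical hn x) (dos hn) ∂(sphereLaw n)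
      ≤ ∫ x, (∑ i ∈ Finset.range k, Y i x + (4 * δ + 4 / u ^ 2 * 2)) ∂(sphereLaw n) := by
        refine integral_mono_ae (lipschitzWith_dBL hn).integrable_unitSphereLaw
          (hS.add (integrable_const _)) ?_
        filter_upwards [ae_lintegral_sq_empirical_le hn] with x hx
        exact dBL_le_sum_ramp zero_le_two hx (lintegral_sq_dos_le hn) hu0 hδ0 hkδ
    _ = ∑ i ∈ Finset.range k, ∫ x, Y i x ∂(sphereLaw n) + (4 * δ + 4 / u ^ 2 * 2) := by
        rw [integral_add hS (integrable_const _), integral_finsetSum _ hYi]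
        simp
    _ ≤ ∑ i ∈ Finset.range k, 91 / √n + (4 * (2 / u ^ 2) + 4 / u ^ 2 * 2) := by
        gcongr with i hi
        exact integral_abs_integral_ramp_sub_le hn hδ0.le _
    _ ≤ 182 / u ^ 2 + (4 * (2 / u ^ 2) + 4 / u ^ 2 * 2) := by
        gcongr
        rw [Finset.sum_const, Finset.card_range, nsmul_eq_mul, hu6, mul_div_assoc',
          div_le_div_iff₀ (by positivity) (by positivity)]
        have : k * u ^ 2 ≤ 2 * u ^ 3 * u ^ 2 := by gcongr
        have h5 : u ^ 5 ≤ u ^ 6 := pow_le_pow_right₀ hu1 (by norm_num)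
        nlinarith
    _ = 198 / (n : ℝ) ^ (1 / 6 : ℝ) := by rw [hu2]; ring

theorem dBL_tail_le (hn : 2 ≤ n) {t : ℝ} (ht : 0 ≤ t) :
    (sphereLaw n).real {x | 198 / (n : ℝ) ^ (1 / 6 : ℝ) + t ≤ dBL (empirical hn x) (dos hn)} ≤
      2 * Real.exp (-(1 / 512) * n * t ^ 2) := by
  have := nontrivial_coeff hn
  have := sphereLaw_prob hn
  have h := (lipschitzWith_dBL hn).unitSphereLaw_mean_add_le_le two_pos ht
  have hsub : {x | 198 / (n : ℝ) ^ (1 / 6 : ℝ) + t ≤ dBL (empirical hn x) (dos hn)} ⊆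
      {x | ∫ v, dBL (empirical hn v) (dos hn) ∂(sphereLaw n) + t ≤
        dBL (empirical hn x) (dos hn)} := fun x hx =>
    le_trans (add_le_add_left (integral_dBL_le hn) t) hx
  refine (measureReal_mono hsub).trans (h.trans_eq ?_)
  -- With dimension `9n` and Lipschitz constant 2, the exponent is `9n t² / (1152 · 4) = n t² /
  -- 512`.
  rw [finrank_coeff]
  push_cast
  congr 2
  ring

/-- The first Borel–Cantelli lemma with deviation `t = n^{-1/6}`; it needs only the individual laws
of the `X n`. -/
theorem ae_eventually_dBL_le {Ω : Type*} [MeasurableSpace Ω] (P : Measure Ω)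
    [IsProbabilityMeasure P] (X : (n : ℕ) → Ω → Coeff n)
    (hX : ∀ n : ℕ, 2 ≤ n → HasLaw (X n) (sphereLaw n) P) :
    ∀ᵐ ω ∂P, ∀ᶠ n : ℕ in atTop, ∀ hn : 2 ≤ n,
      dBL (empirical hn (X n ω)) (dos hn) ≤ 199 / (n : ℝ) ^ (1 / 6 : ℝ) := by
  set s : ℕ → Set Ω := fun n => {ω | ∃ hn : 2 ≤ n, 198 / (n : ℝ) ^ (1 / 6 : ℝ) +
    1 / (n : ℝ) ^ (1 / 6 : ℝ) ≤ dBL (empirical hn (X n ω)) (dos hn)} with hs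
  -- The tail at `t = n^{-1/6}` is `2 exp (-n^{2/3}/512)`. Using `exp y ≥ y³/3!` makes it at most `A
  -- / n²`, which is summable.
  set A : ℝ := 2 * (6 * 512 ^ 3) with hA
  have hbound : ∀ n, P (s n) ≤ ENNReal.ofReal (A * (1 / (n : ℝ) ^ 2)) := by
    intro n
    by_cases hn : 2 ≤ n
    · have := sphereLaw_prob hn
      have hn0 : (0 : ℝ) < n := Nat.cast_pos.2 (by omega)
      set S : Set (Coeff n) := {x | 198 / (n : ℝ) ^ (1 / 6 : ℝ) + 1 / (n : ℝ) ^ (1 / 6 : ℝ) ≤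
        dBL (empirical hn x) (dos hn)} with hS
      have hSm : MeasurableSet S :=
        measurableSet_le measurable_const (lipschitzWith_dBL hn).continuous.measurable
      have e : s n = X n ⁻¹' S := by
        ext ω
        simp [hs, hS, hn]
      rw [e, ← Measure.map_apply_of_aemeasurable (hX n hn).aemeasurable hSm, (hX n hn).map_eq,
        ← ofReal_measureReal]
      refine ENNReal.ofReal_le_ofReal
        ((dBL_tail_le hn (t := 1 / (n : ℝ) ^ (1 / 6 : ℝ)) (by positivity)).trans ?_)
      set w : ℝ := (n : ℝ) ^ (1 / 6 : ℝ) with hw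
      have hw0 : 0 < w := by positivity
      have hw6 : w ^ 6 = n := by
        rw [hw, ← Real.rpow_natCast, ← Real.rpow_mul (by positivity)]; norm_num
      have he := Real.pow_div_factorial_le_exp (1 / 512 * w ^ 4) (by positivity) 3
      have e1 : -(1 / 512) * (n : ℝ) * (1 / w) ^ 2 = -(1 / 512 * w ^ 4) := by
        rw [← hw6]; field_simp
      rw [e1, Real.exp_neg, hA, mul_assoc]
      refine mul_le_mul_of_nonneg_left ?_ zero_le_two
      have e2 : (1 / 512 * w ^ 4) ^ 3 / (Nat.factorial 3 : ℝ) =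
          (6 * 512 ^ 3 * (1 / (n : ℝ) ^ 2))⁻¹ := by
        rw [← hw6, show Nat.factorial 3 = 6 by rfl]; push_cast; field_simp
      rw [e2] at he
      exact inv_le_of_inv_le₀ (by positivity) he
    · have : s n = ∅ := by
        ext ω
        simp [hs, hn]
      rw [this, measure_empty]
      exact zero_le
  have hsum : Summable fun n : ℕ => A * (1 / (n : ℝ) ^ 2) :=
    (Real.summable_one_div_nat_pow.2 one_lt_two).mul_left _
  have hfin : ∑' n, P (s n) ≠ ∞ := by
    refine ne_top_of_le_ne_top ?_ (ENNReal.tsum_le_tsum hbound)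
    rw [← ENNReal.ofReal_tsum_of_nonneg (fun n => by positivity) hsum]
    exact ENNReal.ofReal_ne_top
  filter_upwards [ae_eventually_notMem hfin] with ω hω
  filter_upwards [hω] with n hnω hn
  by_contra hc
  refine hnω ⟨hn, ?_⟩
  rw [← add_div]
  norm_num
  norm_num at hc
  exact hc.le

end Concentration

end SpinChain

/-! ### The main theorem -/

theorem theorem13 :
    ∃ C C' c : ℝ, 0 < C ∧ 0 < C' ∧ 0 < c ∧
      (∀ (n : ℕ) (hn : 2 ≤ n),
        Integrable (fun x => SpinChain.dBL (SpinChain.empirical hn x) (SpinChain.dos hn))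
            (SpinChain.sphereLaw n) ∧
          ∫ x, SpinChain.dBL (SpinChain.empirical hn x) (SpinChain.dos hn)
              ∂(SpinChain.sphereLaw n) ≤ C / (n : ℝ) ^ (1 / 6 : ℝ)) ∧
      (∀ (n : ℕ) (hn : 2 ≤ n) (t : ℝ), 0 ≤ t →
        (SpinChain.sphereLaw n).real
            {x | C / (n : ℝ) ^ (1 / 6 : ℝ) + t ≤
              SpinChain.dBL (SpinChain.empirical hn x) (SpinChain.dos hn)} ≤
          C * Real.exp (-c * n * t ^ 2)) ∧
      (∀ (Ω : Type*) [MeasurableSpace Ω] (P : Measure Ω) [IsProbabilityMeasure P]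
        (X : (n : ℕ) → Ω → SpinChain.Coeff n),
        (∀ n : ℕ, 2 ≤ n → HasLaw (X n) (SpinChain.sphereLaw n) P) →
          ∀ᵐ ω ∂P, ∀ᶠ n : ℕ in atTop, ∀ hn : 2 ≤ n,
            SpinChain.dBL (SpinChain.empirical hn (X n ω)) (SpinChain.dos hn) ≤
              C' / (n : ℝ) ^ (1 / 6 : ℝ)) := by
  -- One constant `C = 198` serves for the mean and also covers the tail prefactor 2; `C' = 199`
  -- adds the deviation `n^{-1/6}`.
  refine ⟨198, 199, 1 / 512, by norm_num, by norm_num, by norm_num, fun n hn => ⟨?_, ?_⟩,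
    fun n hn t ht => (SpinChain.dBL_tail_le hn ht).trans ?_, ?_⟩
  · have := SpinChain.nontrivial_coeff hn
    exact (SpinChain.lipschitzWith_dBL hn).integrable_unitSphereLaw
  · exact SpinChain.integral_dBL_le hn
  · gcongr
    norm_num
  · intro Ω _ P _ X hX
    exact SpinChain.ae_eventually_dBL_le P X hX
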